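/- Let $n\ge 2$ and work over $\mathbb{C}$. Let $A_n=\mathbb{C}[x_1^{\pm1},\dots,x_n^{\pm1}]$, $\partial_i=x_i\frac{\partial}{\partial x_i}$, let $\mathcal{K}_n=A_n[\partial_1,\dots,\partial_n]$ be the Weyl algebra over $A_n$ (the algebra of linear operators on $A_n$ generated by $A_n$ and the $\partial_i$), $W_n=\mathrm{Der}(A_n)$, $D(u,r)=x^r\sum_i u_i\partial_i$ for $u\in\mathbb{C}^n$, $r\in\mathbb{Z}^n$, and let $$\mathbb{S}_n=\mathrm{span}\{D(u,r) : (u|r)=0\},\qquad (u|r)=\sum_i u_ir_i,$$ be the Lie algebra of divergence zero vector fields on the torus, with Cartan subalgebra $\mathfrak{h}=\mathrm{span}\{\partial_1,\dots,\partial_n\}$. For an $\mathbb{S}_n$-module (or $\mathcal{K}_n$-module) $M$ write $\mathfrak{h}M$ for the span of all $hm$, $h\in\mathfrak{h}$, $m\in M$. For $0\le k\le n$ let $V(\delta_k)=\bigwedge^k(\mathbb{C}^n)$ as a $\mathfrak{gl}_n$-module. For a $\mathcal{K}_n$-module $P$ let $\mathcal{F}(P,V(\delta_k))=P\otimes V(\delta_k)$,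 with the $W_n$-action in which $X=\sum_j f_j\partial_j$ acts by $$X(p\otimes w)=Xp\otimes w+\sum_{i,j}\partial_i(f_j)\,p\otimes E_{ij}w;$$ in particular $D(u,r)(p\otimes w)=D(u,r)p\otimes w+x^rp\otimes(ru^T)w$. The maps $$d_k:\mathcal{F}(P,V(\delta_k))\to\mathcal{F}(P,V(\delta_{k+1})),\qquad d_k(p\otimes w)=\sum_{i=1}^n\partial_ip\otimes(e_i\wedge w)$$ are $W_n$-homomorphisms. Put $\mathcal{L}_n(P,0)=0$, $\mathcal{L}_n(P,k)=\mathrm{im}(d_{k-1})$ for $k\ge1$, and $\widetilde{\mathcal{L}}_n(P,k)=\{y\in\mathcal{F}(P,V(\delta_k)) : W_ny\subseteq\mathcal{L}_n(P,k)\}$. Let $A'_n=\bigoplus_{r\ne0}\mathbb{C}x^r\subset A_n$, an $\mathbb{S}_n$-submodule of $A_n$. **Theorem.** Let $P$ be a simple $\mathcal{K}_n$-module. (Isomorphisms with $A_n$ are isomorphisms of $\mathcal{K}_n$-modules; simple, submodule and maximal refer to $\mathbb{S}_n$.) (a) $\mathcal{F}(P,V(\delta_0))$ is irreducible if and only if $\mathfrak{h}P=P$.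 (b) $\mathcal{F}(P,V(\delta_k))$ is not irreducible for $1\le k\le n-1$. (c) If $P\not\cong A_n$, then $\mathfrak{h}\mathcal{F}(P,V(\delta_0))$ is a simple submodule of $\mathcal{F}(P,V(\delta_0))$ and the only one, and every nonzero submodule of $\mathcal{F}(P,V(\delta_0))$ is of the form $P'\otimes V(\delta_0)$ for a subspace $P'$ with $\mathfrak{h}P\subseteq P'\subseteq P$. If $P\cong A_n$, then $\mathcal{F}(P,V(\delta_0))\cong A'_n\oplus\mathbb{C}$ as $\mathbb{S}_n$-modules, where $\mathbb{C}$ is the trivial one-dimensional module. (d) If $P\not\cong A_n$, then $\mathfrak{h}\mathcal{L}_n(P,1)$ is a simple submodule of $\mathcal{L}_n(P,1)$ and the only one. If $P\cong A_n$, then $\mathcal{L}_n(P,1)=\mathfrak{h}\mathcal{L}_n(P,1)\cong A'_n$ as $\mathbb{S}_n$-modules. In particular, $\mathcal{L}_n(P,1)$ is simple if and only if $\mathfrak{h}P=P$ or $P\cong A_n$. (e) If $n\ge3$ and $2\le k\le n-1$, then $\mathcal{L}_n(P,k)$ is simple, and $\widetilde{\mathcal{L}}_n(P,k)$ is a maximal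 submodule of $\mathcal{F}(P,V(\delta_k))$. -/

import Mathlib

open scoped TensorProduct

noncomputable section

namespace DivZeroTorus

/-! ### Laurent polynomials, the Witt algebra and its divergence zero subalgebra -/

/-- The Laurent polynomial algebra `A_n = ℂ[x_1^{±1}, …, x_n^{±1}]`. -/
def A (n : ℕ) : Type := AddMonoidAlgebra ℂ (Fin n → ℤ)

instance (n : ℕ) : CommRing (A n) := inferInstanceAs (CommRing (AddMonoidAlgebra ℂ (Fin n → ℤ)))

instance (n : ℕ) : Algebra ℂ (A n) :=
  inferInstanceAs (Algebra ℂ (AddMonoidAlgebra ℂ (Fin n → ℤ)))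

/-- The monomial `x^r`. -/
def mon {n : ℕ} (r : Fin n → ℤ) : A n :=
  (AddMonoidAlgebra.single r 1 : AddMonoidAlgebra ℂ (Fin n → ℤ))

/-- The monomials form a basis of `A_n`. -/
def monBasis (n : ℕ) : Module.Basis (Fin n → ℤ) ℂ (A n) :=
  Module.Basis.ofRepr (AddMonoidAlgebra.coeffLinearEquiv ℂ)

theorem monBasis_apply {n : ℕ} (r : Fin n → ℤ) : monBasis n r = mon r := rfl

theorem mon_mul {n : ℕ} (r s : Fin n → ℤ) : mon r * mon s = mon (r + s) := by
  have h := AddMonoidAlgebra.single_mul_single (R := ℂ) r s 1 1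
  rw [mul_one] at h
  exact h

theorem mon_zero {n : ℕ} : mon (0 : Fin n → ℤ) = 1 := rfl

theorem mon_neg_mul {n : ℕ} (r : Fin n → ℤ) : mon (-r) * mon r = 1 := by
  rw [mon_mul, neg_add_cancel, mon_zero]

/-- Linear maps out of `A_n` are determined by their values on monomials. -/
theorem A_ext {n : ℕ} {M : Type*} [AddCommGroup M] [Module ℂ M] {f g : A n →ₗ[ℂ] M}
    (h : ∀ r, f (mon r) = g (mon r)) : f = g := by
  exact (monBasis n).ext h

/-- The linear map `x^r ↦ r_i x^r`. -/
def pdLin {n : ℕ} (i : Fin n) : A n →ₗ[ℂ] A n :=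
  (monBasis n).constr ℂ fun r => (r i : ℂ) • mon r

theorem pdLin_mon {n : ℕ} (i : Fin n) (r : Fin n → ℤ) :
    pdLin i (mon r) = (r i : ℂ) • mon r := by
  simp only [← monBasis_apply, pdLin, Module.Basis.constr_basis]

/-- The Witt algebra `W_n = Der(A_n)`. -/
abbrev W (n : ℕ) : Type := Derivation ℂ (A n) (A n)

theorem pdLin_leibniz {n : ℕ} (i : Fin n) (a b : A n) :
    pdLin i (a * b) = a • pdLin i b + b • pdLin i a := by
  have key : (LinearMap.mul ℂ (A n)).compr₂ (pdLin i) =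
      (LinearMap.mul ℂ (A n)).compl₂ (pdLin i) +
        ((LinearMap.mul ℂ (A n)).compl₂ (pdLin i)).flip := by
    apply A_ext
    intro r
    apply A_ext
    intro s
    simp only [LinearMap.compr₂_apply, LinearMap.mul_apply', mon_mul, pdLin_mon,
      LinearMap.add_apply, LinearMap.compl₂_apply, LinearMap.flip_apply, mul_smul_comm]
    rw [add_comm s r, ← add_smul]
    congr 1
    push_cast [Pi.add_apply]
    ring
  simpa using congr($key a b)

/-- The derivation `∂_i = x_i ∂/∂x_i`, so that `∂_i x^r = r_i x^r`. -/
def pd {n : ℕ} (i : Fin n) : W n := Derivation.mk' (pdLin i) (pdLin_leibniz i)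

theorem pd_mon {n : ℕ} (i : Fin n) (r : Fin n → ℤ) : pd i (mon r) = (r i : ℂ) • mon r :=
  pdLin_mon i r

/-- The bilinear pairing `(u | r) = ∑ u_i r_i` of `u ∈ ℂ^n` and `r ∈ ℤ^n`. -/
def pair {n : ℕ} (u : Fin n → ℂ) (r : Fin n → ℤ) : ℂ := ∑ i, u i * (r i : ℂ)

/-- The vector field `D(u, r) = x^r ∑ u_i ∂_i`. -/
def D {n : ℕ} (u : Fin n → ℂ) (r : Fin n → ℤ) : W n := mon r • ∑ i, u i • pd i

theorem D_mon {n : ℕ} (u : Fin n → ℂ) (r s : Fin n → ℤ) :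
    D u r (mon s) = pair u s • mon (r + s) := by
  have h : (∑ i, u i • pd i : W n) (mon s) = pair u s • mon s := by
    rw [← Derivation.coeFnAddMonoidHom_apply, map_sum, Finset.sum_apply]
    simp only [Derivation.coeFnAddMonoidHom_apply, Derivation.smul_apply, pd_mon, smul_smul]
    rw [← Finset.sum_smul, pair]
  rw [D, Derivation.smul_apply, h, smul_eq_mul, mul_smul_comm, mon_mul]

theorem W_ext {n : ℕ} {X Y : W n} (h : ∀ r, X (mon r) = Y (mon r)) : X = Y := by
  have : (X : A n →ₗ[ℂ] A n) = Y := A_ext h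
  exact Derivation.coe_injective (by ext1 a; exact congr($this a))

theorem pair_add {n : ℕ} (w : Fin n → ℂ) (a b : Fin n → ℤ) :
    pair w (a + b) = pair w a + pair w b := by
  simp [pair, mul_add, Finset.sum_add_distrib]

theorem pair_comb {n : ℕ} (a b : ℂ) (w z : Fin n → ℂ) (c : Fin n → ℤ) :
    pair (a • w - b • z) c = a * pair w c - b * pair z c := by
  simp [pair, sub_mul, Finset.sum_sub_distrib, Finset.mul_sum, mul_assoc]

theorem D_lie {n : ℕ} (u v : Fin n → ℂ) (r s : Fin n → ℤ) :
    ⁅D u r, D v s⁆ = D (pair u s • v - pair v r • u) (r + s) := by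
  apply W_ext
  intro t
  rw [Derivation.commutator_apply]
  simp only [D_mon, Derivation.map_smul, smul_smul, pair_add, pair_comb]
  rw [← add_assoc, ← add_assoc, add_comm s r, ← sub_smul]
  congr 1
  ring

/-- The spanning set of the divergence zero vector fields. -/
def divZeroSet (n : ℕ) : Set (W n) := {X | ∃ u r, pair u r = 0 ∧ X = D u r}

theorem divZero_lie {n : ℕ} {X Y : W n} (hX : X ∈ Submodule.span ℂ (divZeroSet n))
    (hY : Y ∈ Submodule.span ℂ (divZeroSet n)) : ⁅X, Y⁆ ∈ Submodule.span ℂ (divZeroSet n) := by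
  induction hX using Submodule.span_induction with
  | zero => rw [show ⁅(0 : W n), Y⁆ = 0 from zero_lie Y]; exact zero_mem _
  | add a b _ _ ha hb =>
    rw [show ⁅a + b, Y⁆ = ⁅a, Y⁆ + ⁅b, Y⁆ from add_lie a b Y]; exact add_mem ha hb
  | smul c a _ ha =>
    rw [show ⁅c • a, Y⁆ = c • ⁅a, Y⁆ from smul_lie c a Y]; exact Submodule.smul_mem _ _ ha
  | mem a ha =>
    induction hY using Submodule.span_induction with
    | zero => rw [show ⁅a, (0 : W n)⁆ = 0 from lie_zero a]; exact zero_mem _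
    | add b c _ _ hb hc =>
      rw [show ⁅a, b + c⁆ = ⁅a, b⁆ + ⁅a, c⁆ from lie_add a b c]; exact add_mem hb hc
    | smul c b _ ha =>
      rw [show ⁅a, c • b⁆ = c • ⁅a, b⁆ from lie_smul c a b]; exact Submodule.smul_mem _ _ ha
    | mem b hb =>
      obtain ⟨u, r, hu, rfl⟩ := ha
      obtain ⟨v, s, hv, rfl⟩ := hb
      apply Submodule.subset_span
      refine ⟨_, _, ?_, D_lie u v r s⟩
      rw [pair_comb, pair_add, pair_add, hu, hv]
      ring

/-- The Lie algebra `𝕊_n` of divergence zero vector fields on the torus: the span of the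
`D(u, r)` with `(u | r) = 0`. -/
def S (n : ℕ) : LieSubalgebra ℂ (W n) where
  toSubmodule := Submodule.span ℂ (divZeroSet n)
  lie_mem' := divZero_lie

theorem D_mem_S {n : ℕ} {u : Fin n → ℂ} {r : Fin n → ℤ} (h : pair u r = 0) : D u r ∈ S n :=
  Submodule.subset_span ⟨u, r, h, rfl⟩

theorem pd_eq_D {n : ℕ} (i : Fin n) : (pd i : W n) = D (Pi.single i 1) 0 := by
  apply W_ext
  intro t
  rw [D_mon, pd_mon, zero_add]
  congr 1
  simp [pair, Pi.single_apply]

theorem pd_mem_S {n : ℕ} (i : Fin n) : pd i ∈ S n := by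
  rw [pd_eq_D]
  exact D_mem_S (by simp [pair])

/-- The Cartan subalgebra `𝔥 = span {∂_1, …, ∂_n}`, as a subspace of `𝕊_n`. -/
def cartan (n : ℕ) : Submodule ℂ (S n) :=
  Submodule.span ℂ (Set.range fun i : Fin n => (⟨pd i, pd_mem_S i⟩ : S n))

/-- For an `𝕊_n`-module `M`, the subspace `𝔥M` spanned by all `h m` with `h ∈ 𝔥`, `m ∈ M`. -/
def hMul (n : ℕ) (M : Type*) [AddCommGroup M] [Module ℂ M] [LieRingModule (S n) M] :
    Submodule ℂ M :=
  Submodule.span ℂ {y | ∃ h ∈ cartan n, ∃ m : M, y = ⁅h, m⁆}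

/-- The `𝕊_n`-submodule `A'_n` of `A_n` spanned by the `x^r` with `r ≠ 0`. -/
def Aprime (n : ℕ) : LieSubmodule ℂ (S n) (A n) where
  toSubmodule := Submodule.span ℂ {f | ∃ r : Fin n → ℤ, r ≠ 0 ∧ f = mon r}
  lie_mem := by
    rintro ⟨X, hX⟩ m hm
    change X m ∈ Submodule.span ℂ _
    replace hm : m ∈ Submodule.span ℂ {f | ∃ r : Fin n → ℤ, r ≠ 0 ∧ f = mon r} := hm
    replace hX : X ∈ Submodule.span ℂ (divZeroSet n) := hX
    induction hX using Submodule.span_induction with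
    | zero => simp
    | add a b _ _ ha hb => rw [Derivation.add_apply]; exact add_mem ha hb
    | smul c a _ ha => rw [Derivation.smul_apply]; exact Submodule.smul_mem _ _ ha
    | mem a ha =>
      obtain ⟨u, s, hu, rfl⟩ := ha
      induction hm using Submodule.span_induction with
      | zero => simp
      | add a b _ _ ha hb => rw [map_add]; exact add_mem ha hb
      | smul c a _ ha => rw [Derivation.map_smul]; exact Submodule.smul_mem _ _ ha
      | mem b hb =>
        obtain ⟨r, hr, rfl⟩ := hb
        rw [D_mon]
        by_cases h : s + r = 0
        · have : pair u r = 0 := by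
            rw [eq_neg_of_add_eq_zero_right h]
            have : pair u (-s) = - pair u s := by simp [pair]
            rw [this, hu, neg_zero]
          rw [this, zero_smul]
          exact zero_mem _
        · exact Submodule.smul_mem _ _ (Submodule.subset_span ⟨_, h, rfl⟩)

/-! ### The Weyl algebra -/

/-- The algebra of linear operators on `A_n` generated by the multiplications by elements of `A_n`
and by `∂_1, …, ∂_n`. -/
def weylSubalgebra (n : ℕ) : Subalgebra ℂ (Module.End ℂ (A n)) :=
  Algebra.adjoin ℂ (Set.range (fun a : A n => LinearMap.mulLeft ℂ a) ∪
    Set.range (fun i : Fin n => ((pd i : W n) : A n →ₗ[ℂ] A n)))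

/-- The Weyl algebra `𝒦_n = A_n[∂_1, …, ∂_n]` over `A_n`, realised as the algebra of differential
operators on `A_n`. -/
def K (n : ℕ) : Type := weylSubalgebra n

instance (n : ℕ) : Ring (K n) := inferInstanceAs (Ring (weylSubalgebra n))

instance (n : ℕ) : Algebra ℂ (K n) := inferInstanceAs (Algebra ℂ (weylSubalgebra n))

/-- The natural `𝒦_n`-module `A_n`. -/
instance (n : ℕ) : Module (K n) (A n) := inferInstanceAs (Module (weylSubalgebra n) (A n))

instance (n : ℕ) : IsScalarTower ℂ (K n) (A n) :=
  inferInstanceAs (IsScalarTower ℂ (weylSubalgebra n) (A n))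

/-- Elements of `𝒦_n` are determined by their action on monomials. -/
theorem K_ext {n : ℕ} {y z : K n} (h : ∀ r : Fin n → ℤ, y • (mon r : A n) = z • (mon r : A n)) :
    y = z :=
  Subtype.ext (A_ext h)

/-- The inclusion `A_n → 𝒦_n`. -/
def mulK (n : ℕ) : A n →ₐ[ℂ] K n :=
  AlgHom.codRestrict (Algebra.lmul ℂ (A n)) (weylSubalgebra n) fun a =>
    Algebra.subset_adjoin (Or.inl ⟨a, rfl⟩)

theorem mulK_smul {n : ℕ} (a b : A n) : mulK n a • b = a * b := rfl

/-- `∂_i` as an element of `𝒦_n`. -/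
def pdK {n : ℕ} (i : Fin n) : K n :=
  (⟨((pd i : W n) : A n →ₗ[ℂ] A n), Algebra.subset_adjoin (Or.inr ⟨i, rfl⟩)⟩ : weylSubalgebra n)

theorem pdK_smul {n : ℕ} (i : Fin n) (b : A n) : pdK i • b = pd i b := rfl

/-- The coefficient `f_j` of `∂_j` in a vector field `X = ∑ f_j ∂_j`, that is
`f_j = x_j^{-1} X(x_j)`. -/
def vcoef {n : ℕ} (X : W n) (j : Fin n) : A n :=
  mon (-Pi.single j 1) * X (mon (Pi.single j 1))

theorem W_apply_mon {n : ℕ} (X : W n) (r : Fin n → ℤ) :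
    X (mon r) = ∑ j, vcoef X j * ((r j : ℂ) • mon r) := by
  let g : (Fin n → ℤ) →+ A n := AddMonoidHom.mk' (fun r => mon (-r) * X (mon r)) (by
    intro a b
    rw [← mon_mul, Derivation.leibniz, smul_eq_mul, smul_eq_mul, neg_add, ← mon_mul]
    linear_combination (mon (-b) * X (mon b)) * mon_neg_mul a +
      (mon (-a) * X (mon a)) * mon_neg_mul b)
  have h1 : g r = ∑ j, r j • vcoef X j := by
    conv_lhs => rw [← Finset.univ_sum_single r]
    rw [map_sum]
    refine Finset.sum_congr rfl fun j _ => ?_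
    have : (Pi.single j (r j) : Fin n → ℤ) = r j • Pi.single j 1 := by
      rw [← Pi.single_smul, smul_eq_mul, mul_one]
    rw [this, map_zsmul]
    rfl
  have h2 : X (mon r) = g r * mon r := by
    change X (mon r) = mon (-r) * X (mon r) * mon r
    linear_combination (-X (mon r)) * mon_neg_mul r
  rw [h2, h1, Finset.sum_mul]
  refine Finset.sum_congr rfl fun j _ => ?_
  rw [mul_smul_comm, smul_mul_assoc, Int.cast_smul_eq_zsmul]

/-- Every vector field is `X = ∑ f_j ∂_j`. -/
theorem W_eq_sum {n : ℕ} (X : W n) : X = ∑ j, vcoef X j • pd j := by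
  apply W_ext
  intro r
  rw [W_apply_mon, ← Derivation.coeFnAddMonoidHom_apply (∑ j, vcoef X j • pd j), map_sum,
    Finset.sum_apply]
  simp only [Derivation.coeFnAddMonoidHom_apply, Derivation.smul_apply, pd_mon, smul_eq_mul]

theorem W_mem_K {n : ℕ} (X : W n) : (X : A n →ₗ[ℂ] A n) ∈ weylSubalgebra n := by
  have h : (X : A n →ₗ[ℂ] A n) = ∑ j, LinearMap.mulLeft ℂ (vcoef X j) *
      ((pd j : W n) : A n →ₗ[ℂ] A n) := by
    apply A_ext
    intro r
    rw [LinearMap.sum_apply]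
    change X (mon r) = ∑ j, vcoef X j * pd j (mon r)
    simp only [W_apply_mon X r, pd_mon]
  rw [h]
  exact sum_mem fun j _ => mul_mem (Algebra.subset_adjoin (Or.inl ⟨_, rfl⟩))
    (Algebra.subset_adjoin (Or.inr ⟨_, rfl⟩))

/-- The inclusion `W_n ⊆ 𝒦_n` of vector fields into differential operators. -/
def WtoK (n : ℕ) : W n →ₗ[ℂ] K n where
  toFun X := (⟨(X : A n →ₗ[ℂ] A n), W_mem_K X⟩ : weylSubalgebra n)
  map_add' _ _ := rfl
  map_smul' _ _ := rfl

theorem WtoK_apply_smul {n : ℕ} (X : W n) (a : A n) : WtoK n X • a = X a := rfl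

theorem WtoK_pd {n : ℕ} (i : Fin n) : WtoK n (pd i) = pdK i := rfl

theorem WtoK_lie {n : ℕ} (X Y : W n) :
    WtoK n ⁅X, Y⁆ = WtoK n X * WtoK n Y - WtoK n Y * WtoK n X := by
  apply K_ext
  intro r
  rw [sub_smul, mul_smul, mul_smul]
  exact Derivation.commutator_apply _

theorem WtoK_mul {n : ℕ} (X : W n) (a : A n) :
    WtoK n X * mulK n a = mulK n a * WtoK n X + mulK n (X a) := by
  apply K_ext
  intro r
  rw [add_smul, mul_smul, mul_smul, WtoK_apply_smul, WtoK_apply_smul, mulK_smul, mulK_smul,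
    mulK_smul, Derivation.leibniz, smul_eq_mul, smul_eq_mul, mul_comm (X a)]

theorem WtoK_smul {n : ℕ} (a : A n) (X : W n) : WtoK n (a • X) = mulK n a * WtoK n X := rfl

/-- For a `𝒦_n`-module `P`, the subspace `𝔥P = ∑ ∂_i P`. -/
def hP (n : ℕ) (P : Type*) [AddCommGroup P] [Module ℂ P] [Module (K n) P] : Submodule ℂ P :=
  Submodule.span ℂ {y | ∃ (i : Fin n) (p : P), y = (pdK i : K n) • p}

/-! ### The modules `𝓕(P, V)` -/

/-- The Lie algebra `𝔤𝔩_n`. -/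
abbrev gl (n : ℕ) : Type := Matrix (Fin n) (Fin n) ℂ

/-- The vector space `𝓕(P, V) = P ⊗ V`. -/
def F (n : ℕ) (P V : Type*) [AddCommGroup P] [Module ℂ P] [AddCommGroup V] [Module ℂ V] :=
  P ⊗[ℂ] V

section FInst
variable (n : ℕ) (P V : Type*) [AddCommGroup P] [Module ℂ P] [AddCommGroup V] [Module ℂ V]

instance : AddCommGroup (F n P V) := inferInstanceAs (AddCommGroup (P ⊗[ℂ] V))
instance : Module ℂ (F n P V) := inferInstanceAs (Module ℂ (P ⊗[ℂ] V))

end FInst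

section Action

attribute [local instance] LieRing.ofAssociativeRing

variable {n : ℕ} {P V : Type*} [AddCommGroup P] [Module ℂ P] [Module (K n) P]
  [IsScalarTower ℂ (K n) P] [AddCommGroup V] [Module ℂ V]

variable (n P) in
/-- The action of `𝒦_n` on `P` by linear operators. -/
def actP : K n →ₐ[ℂ] Module.End ℂ P := Algebra.lsmul ℂ ℂ P

theorem actP_apply (y : K n) (p : P) : actP n P y p = y • p := rfl

/-- The operator `y ⊗ T` on `P ⊗ V`, for `y ∈ 𝒦_n` and `T ∈ End(V)`. -/
def opT (y : K n) (T : Module.End ℂ V) : Module.End ℂ (P ⊗[ℂ] V) :=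
  TensorProduct.map (actP n P y) T

theorem opT_tmul (y : K n) (T : Module.End ℂ V) (p : P) (v : V) :
    opT y T (p ⊗ₜ[ℂ] v) = (y • p) ⊗ₜ[ℂ] T v := rfl

theorem opT_mul (y z : K n) (T U : Module.End ℂ V) :
    (opT y T * opT z U : Module.End ℂ (P ⊗[ℂ] V)) = opT (y * z) (T * U) := by
  rw [opT, opT, opT, map_mul, TensorProduct.map_mul]

theorem opT_add_left (y z : K n) (T : Module.End ℂ V) :
    (opT (y + z) T : Module.End ℂ (P ⊗[ℂ] V)) = opT y T + opT z T := by
  rw [opT, opT, opT, map_add, TensorProduct.map_add_left]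

theorem opT_sub_left (y z : K n) (T : Module.End ℂ V) :
    (opT (y - z) T : Module.End ℂ (P ⊗[ℂ] V)) = opT y T - opT z T := by
  rw [eq_sub_iff_add_eq, ← opT_add_left, sub_add_cancel]

theorem opT_smul_left (c : ℂ) (y : K n) (T : Module.End ℂ V) :
    (opT (c • y) T : Module.End ℂ (P ⊗[ℂ] V)) = c • opT y T := by
  rw [opT, opT, map_smul, TensorProduct.map_smul_left]

theorem opT_sub_right (y : K n) (T U : Module.End ℂ V) :
    (opT y (T - U) : Module.End ℂ (P ⊗[ℂ] V)) = opT y T - opT y U := by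
  rw [eq_sub_iff_add_eq, opT, opT, opT, ← TensorProduct.map_add_right, sub_add_cancel]

theorem opT_zero_right (y : K n) :
    (opT y (0 : Module.End ℂ V) : Module.End ℂ (P ⊗[ℂ] V)) = 0 := by
  rw [opT, TensorProduct.map_zero_right]

variable [LieRingModule (gl n) V] [LieModule ℂ (gl n) V]

/-- The matrix unit `E_ij` acting on `V`. -/
def E (V : Type*) [AddCommGroup V] [Module ℂ V] [LieRingModule (gl n) V] [LieModule ℂ (gl n) V]
    (i j : Fin n) : Module.End ℂ V :=
  LieModule.toEnd ℂ (gl n) V (Matrix.single i j 1)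

theorem E_comm (i j k l : Fin n) : E V i j * E V k l - E V k l * E V i j =
    (if j = k then E V i l else 0) - (if l = i then E V k j else 0) := by
  have h : E V i j * E V k l - E V k l * E V i j =
      LieModule.toEnd ℂ (gl n) V ⁅(Matrix.single i j 1 : gl n), (Matrix.single k l 1 : gl n)⁆ := by
    rw [LieHom.map_lie]; rfl
  rw [h, Ring.lie_def]
  have key : ∀ a b c d : Fin n, (Matrix.single a b 1 * Matrix.single c d 1 : gl n) =
      if b = c then Matrix.single a d 1 else 0 := by
    intro a b c d
    split_ifs with hh
    · subst hh; simp
    · simp [hh]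
  rw [key, key, map_sub]
  congr 1 <;> split_ifs <;> simp [E]

/-- The operator `∑ a_ij ⊗ E_ij` on `P ⊗ V`, for a matrix `(a_ij)` over `A_n`. -/
def opM (M : Matrix (Fin n) (Fin n) (A n)) : Module.End ℂ (P ⊗[ℂ] V) :=
  ∑ i, ∑ j, opT (mulK n (M i j)) (E V i j)

theorem opM_add (M N : Matrix (Fin n) (Fin n) (A n)) :
    (opM (M + N) : Module.End ℂ (P ⊗[ℂ] V)) = opM M + opM N := by
  simp only [opM, Matrix.add_apply, map_add, opT_add_left, Finset.sum_add_distrib]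

theorem opM_smul (c : ℂ) (M : Matrix (Fin n) (Fin n) (A n)) :
    (opM (c • M) : Module.End ℂ (P ⊗[ℂ] V)) = c • opM M := by
  simp only [opM, Matrix.smul_apply, map_smul, opT_smul_left, Finset.smul_sum]

theorem opM_sub (M N : Matrix (Fin n) (Fin n) (A n)) :
    (opM (M - N) : Module.End ℂ (P ⊗[ℂ] V)) = opM M - opM N := by
  rw [eq_sub_iff_add_eq, ← opM_add, sub_add_cancel]

theorem opM_comm (M N : Matrix (Fin n) (Fin n) (A n)) :
    (opM M * opM N - opM N * opM M : Module.End ℂ (P ⊗[ℂ] V)) = opM (M * N - N * M) := by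
  have e : ∀ L : Matrix (Fin n) (Fin n) (A n), (opM L : Module.End ℂ (P ⊗[ℂ] V)) =
      ∑ x : Fin n × Fin n, opT (mulK n (L x.1 x.2)) (E V x.1 x.2) := by
    intro L
    rw [opM, Fintype.sum_prod_type]
  have h1 : (opM M * opM N - opM N * opM M : Module.End ℂ (P ⊗[ℂ] V)) =
      ∑ x : Fin n × Fin n, ∑ y : Fin n × Fin n,
        (opT (mulK n (M x.1 x.2 * N y.1 y.2)) (if x.2 = y.1 then E V x.1 y.2 else 0) -
        opT (mulK n (M x.1 x.2 * N y.1 y.2)) (if y.2 = x.1 then E V y.1 x.2 else 0)) := by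
    rw [e M, e N, Finset.sum_mul_sum, Finset.sum_mul_sum]
    rw [Finset.sum_comm (f := fun x y : Fin n × Fin n => (opT (mulK n (N x.1 x.2)) (E V x.1 x.2) *
      opT (mulK n (M y.1 y.2)) (E V y.1 y.2) : Module.End ℂ (P ⊗[ℂ] V)))]
    rw [← Finset.sum_sub_distrib]
    refine Finset.sum_congr rfl fun x _ => ?_
    rw [← Finset.sum_sub_distrib]
    refine Finset.sum_congr rfl fun y _ => ?_
    rw [opT_mul, opT_mul, ← map_mul, ← map_mul, mul_comm (N y.1 y.2), ← opT_sub_right,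
      ← opT_sub_right, E_comm]
  rw [h1]
  simp only [Finset.sum_sub_distrib, Fintype.sum_prod_type, apply_ite (opT _), opT_zero_right,
    opM, Matrix.sub_apply, Matrix.mul_apply, map_sub, map_sum, opT_sub_left]
  have hs : ∀ (f : Fin n → K n) (T : Module.End ℂ V),
      (opT (∑ x, f x) T : Module.End ℂ (P ⊗[ℂ] V)) = ∑ x, opT (f x) T := by
    intro f T
    rw [opT, map_sum]
    exact map_sum ((TensorProduct.mapBilinear (RingHom.id ℂ) P V P V).flip T)
      (fun x => actP n P (f x)) Finset.univ
  simp only [hs]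
  congr 1
  · refine Finset.sum_congr rfl fun i _ => ?_
    rw [Finset.sum_comm (s := Finset.univ) (t := Finset.univ) (f := fun l j : Fin n =>
      (opT (mulK n (M i j * N j l)) (E V i l) : Module.End ℂ (P ⊗[ℂ] V)))]
    refine Finset.sum_congr rfl fun j _ => ?_
    simp
  · simp only [Finset.sum_ite_eq', Finset.mem_univ, if_true]
    have hc : ∀ f : Fin n → Fin n → Fin n → Module.End ℂ (P ⊗[ℂ] V),
        ∑ i, ∑ j, ∑ k, f i j k = ∑ k, ∑ j, ∑ i, f i j k := by
      intro f
      rw [Finset.sum_comm, Finset.sum_comm (s := Finset.univ) (f := fun k j => ∑ i, f i j k)]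
      refine Finset.sum_congr rfl fun j _ => ?_
      rw [Finset.sum_comm]
    rw [hc]
    simp only [mul_comm]

/-- The Jacobian matrix `(∂_i f_j)` of a vector field `∑ f_j ∂_j`. -/
def jac (X : W n) : Matrix (Fin n) (Fin n) (A n) := Matrix.of fun i j => pd i (vcoef X j)

theorem vcoef_add (X Y : W n) (j : Fin n) : vcoef (X + Y) j = vcoef X j + vcoef Y j := by
  simp [vcoef, mul_add]

theorem vcoef_smul (c : ℂ) (X : W n) (j : Fin n) : vcoef (c • X) j = c • vcoef X j := by
  simp [vcoef]

theorem vcoef_lie (X Y : W n) (j : Fin n) :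
    vcoef ⁅X, Y⁆ j = X (vcoef Y j) - Y (vcoef X j) := by
  have h : ∀ Z : W n, Z (mon (Pi.single j 1)) = vcoef Z j * mon (Pi.single j 1) := by
    intro Z
    rw [vcoef]
    linear_combination (-Z (mon (Pi.single j 1))) * mon_neg_mul (Pi.single j (1 : ℤ))
  have h' : vcoef ⁅X, Y⁆ j = mon (-Pi.single j 1) *
      (X (vcoef Y j * mon (Pi.single j 1)) - Y (vcoef X j * mon (Pi.single j 1))) := by
    rw [← h, ← h]
    rfl
  rw [h', Derivation.leibniz, Derivation.leibniz, h X, h Y]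
  simp only [smul_eq_mul]
  linear_combination (X (vcoef Y j) - Y (vcoef X j)) * mon_neg_mul (Pi.single j (1 : ℤ))

theorem pd_comm (i j : Fin n) (a : A n) : pd i (pd j a) = pd j (pd i a) := by
  have h : ⁅(pd i : W n), pd j⁆ = 0 := by
    apply W_ext
    intro r
    rw [Derivation.commutator_apply]
    simp only [pd_mon, Derivation.map_smul, Derivation.zero_apply]
    rw [smul_comm, sub_self]
  have h2 : ⁅(pd i : W n), pd j⁆ a = 0 := by rw [h]; rfl
  rw [Derivation.commutator_apply] at h2
  exact sub_eq_zero.mp h2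

theorem W_apply (X : W n) (a : A n) : X a = ∑ l, vcoef X l * pd l a := by
  have h : (X : A n →ₗ[ℂ] A n) = ∑ l, LinearMap.mulLeft ℂ (vcoef X l) ∘ₗ
      ((pd l : W n) : A n →ₗ[ℂ] A n) := by
    apply A_ext
    intro r
    rw [LinearMap.sum_apply]
    change X (mon r) = ∑ j, vcoef X j * pd j (mon r)
    simp only [W_apply_mon X r, pd_mon]
  have h2 := congr($h a)
  rw [LinearMap.sum_apply] at h2
  exact h2

theorem jac_lie (X Y : W n) : jac ⁅X, Y⁆ =
    (Matrix.of fun i j => X (jac Y i j)) - (Matrix.of fun i j => Y (jac X i j)) +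
      (jac X * jac Y - jac Y * jac X) := by
  ext1 i j
  simp only [jac, Matrix.of_apply, Matrix.add_apply, Matrix.sub_apply, Matrix.mul_apply, vcoef_lie,
    map_sub]
  have h : ∀ (Z : W n) (a : A n), pd i (Z a) = ∑ l, pd i (vcoef Z l) * pd l a + Z (pd i a) := by
    intro Z a
    rw [W_apply Z a, W_apply Z (pd i a), map_sum, ← Finset.sum_add_distrib]
    refine Finset.sum_congr rfl fun l _ => ?_
    rw [Derivation.leibniz, smul_eq_mul, smul_eq_mul, pd_comm]
    ring
  rw [h, h]
  ring

theorem opX_comm_opM (X : W n) (M : Matrix (Fin n) (Fin n) (A n)) :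
    (opT (WtoK n X) 1 * opM M - opM M * opT (WtoK n X) 1 : Module.End ℂ (P ⊗[ℂ] V)) =
      opM (Matrix.of fun i j => X (M i j)) := by
  simp only [opM, Finset.mul_sum, Finset.sum_mul, opT_mul, one_mul, mul_one,
    ← Finset.sum_sub_distrib, ← opT_sub_left, WtoK_mul, add_sub_cancel_left, Matrix.of_apply]

variable (n P V) in
/-- The action of `W_n` on `P ⊗ V`: the vector field `X = ∑ f_j ∂_j` acts by
`X (p ⊗ v) = X p ⊗ v + ∑_{i,j} (∂_i f_j) p ⊗ E_ij v`. -/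
def actF : W n →ₗ⁅ℂ⁆ Module.End ℂ (P ⊗[ℂ] V) where
  toFun X := opT (WtoK n X) 1 + opM (jac X)
  map_add' X Y := by
    have : jac (X + Y) = jac X + jac Y := by
      ext1 i j; simp [jac, vcoef_add]
    rw [this, opM_add, map_add, opT_add_left]
    abel
  map_smul' c X := by
    have : jac (c • X) = c • jac X := by
      ext1 i j; simp [jac, vcoef_smul]
    rw [this, opM_smul, map_smul, opT_smul_left, RingHom.id_apply, smul_add]
  map_lie' := by
    intro X Y
    rw [Ring.lie_def, jac_lie, opM_add, opM_sub, ← opX_comm_opM, ← opX_comm_opM, ← opM_comm,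
      WtoK_lie, opT_sub_left]
    have h : ∀ Z U : W n, (opT (WtoK n Z * WtoK n U) 1 : Module.End ℂ (P ⊗[ℂ] V)) =
        opT (WtoK n Z) 1 * opT (WtoK n U) 1 := by
      intro Z U
      rw [opT_mul, one_mul]
    rw [h, h]
    noncomm_ring

instance : LieRingModule (W n) (F n P V) where
  bracket X m := actF n P V X m
  add_lie X Y m := by
    change actF n P V (X + Y) m = _
    rw [map_add]; rfl
  lie_add X m m' := map_add (actF n P V X) m m'
  leibniz_lie X Y m := by
    change actF n P V X (actF n P V Y m) = actF n P V ⁅X, Y⁆ m + actF n P V Y (actF n P V X m)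
    rw [LieHom.map_lie, Ring.lie_def]
    exact (sub_add_cancel (actF n P V X (actF n P V Y m)) (actF n P V Y (actF n P V X m))).symm

instance : LieModule ℂ (W n) (F n P V) where
  smul_lie c X m := by
    change actF n P V (c • X) m = _
    rw [map_smul]; rfl
  lie_smul c X m := map_smul (actF n P V X) c m

theorem lie_def (X : W n) (m : F n P V) : ⁅X, m⁆ = actF n P V X m := rfl

/-- The defining formula `D(u,r)(p ⊗ v) = D(u,r)p ⊗ v + x^r p ⊗ (r uᵀ) v` of the action. -/
theorem D_lie_tmul (u : Fin n → ℂ) (r : Fin n → ℤ) (p : P) (v : V) :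
    (⁅D u r, (p ⊗ₜ[ℂ] v : F n P V)⁆ : F n P V) =
      ((WtoK n (D u r) • p) ⊗ₜ[ℂ] v + (mulK n (mon r) • p) ⊗ₜ[ℂ]
        ⁅Matrix.vecMulVec (fun i => (r i : ℂ)) u, v⁆ : P ⊗[ℂ] V) := by
  have hc : ∀ j, vcoef (D u r) j = u j • mon r := by
    intro j
    rw [vcoef, D_mon, mul_smul_comm, mon_mul]
    congr 1
    · simp [pair, Pi.single_apply]
    · congr 1; abel
  have hE : Matrix.vecMulVec (fun i => (r i : ℂ)) u =
      ∑ i, ∑ j, ((r i : ℂ) * u j) • (Matrix.single i j 1 : gl n) := by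
    conv_lhs => rw [Matrix.matrix_eq_sum_single (Matrix.vecMulVec (fun i => (r i : ℂ)) u)]
    simp [Matrix.vecMulVec_apply, Matrix.smul_single]
  have hv : ⁅Matrix.vecMulVec (fun i => (r i : ℂ)) u, v⁆ =
      ∑ i, ∑ j, ((r i : ℂ) * u j) • E V i j v := by
    have h : ⁅Matrix.vecMulVec (fun i => (r i : ℂ)) u, v⁆ =
      LieModule.toEnd ℂ (gl n) V (Matrix.vecMulVec (fun i => (r i : ℂ)) u) v := rfl
    rw [h, hE]
    simp only [map_sum, map_smul, LinearMap.sum_apply, LinearMap.smul_apply]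
    rfl
  have hM : (opM (jac (D u r)) : Module.End ℂ (P ⊗[ℂ] V)) (p ⊗ₜ[ℂ] v) =
      (mulK n (mon r) • p) ⊗ₜ[ℂ] ⁅Matrix.vecMulVec (fun i => (r i : ℂ)) u, v⁆ := by
    rw [hv]
    simp only [opM, LinearMap.sum_apply, opT_tmul, TensorProduct.tmul_sum, jac, Matrix.of_apply,
      hc, Derivation.map_smul, pd_mon, map_smul, smul_assoc, TensorProduct.tmul_smul,
      TensorProduct.smul_tmul', smul_smul, mul_comm]
  change (opT (WtoK n (D u r)) 1 + opM (jac (D u r)) : Module.End ℂ (P ⊗[ℂ] V)) (p ⊗ₜ[ℂ] v) = _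
  rw [LinearMap.add_apply, hM]
  rfl

end Action

/-! ### Exterior powers of the natural module -/

/-- The `𝔤𝔩_n`-module `V(δ_k) = ⋀^k(ℂ^n)`. -/
def Vd (n k : ℕ) : Type := ⋀[ℂ]^k (Fin n → ℂ)

instance (n k : ℕ) : AddCommGroup (Vd n k) := inferInstanceAs (AddCommGroup (⋀[ℂ]^k (Fin n → ℂ)))

instance (n k : ℕ) : Module ℂ (Vd n k) := inferInstanceAs (Module ℂ (⋀[ℂ]^k (Fin n → ℂ)))

section Ext

variable {n : ℕ}

/-- The decomposable vector `v_1 ∧ ⋯ ∧ v_k`. -/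
def wedges {k : ℕ} : (Fin n → ℂ) [⋀^Fin k]→ₗ[ℂ] Vd n k := exteriorPower.ιMulti ℂ k

theorem Vd_ext {k : ℕ} {M : Type*} [AddCommGroup M] [Module ℂ M] {f g : Vd n k →ₗ[ℂ] M}
    (h : ∀ v, f (wedges v) = g (wedges v)) : f = g :=
  exteriorPower.linearMap_ext (AlternatingMap.ext h)

/-- The exterior product `w ↦ v ∧ w` with a vector. -/
def wedge (k : ℕ) (v : Fin n → ℂ) : Vd n k →ₗ[ℂ] Vd n (k + 1) :=
  (LinearMap.mulLeft ℂ (ExteriorAlgebra.ι ℂ v)).restrict (p := ⋀[ℂ]^k (Fin n → ℂ))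
    (q := ⋀[ℂ]^(k + 1) (Fin n → ℂ)) fun w hw => by
      change ExteriorAlgebra.ι ℂ v * w ∈ LinearMap.range (ExteriorAlgebra.ι ℂ) ^ (k + 1)
      rw [pow_succ']
      exact Submodule.mul_mem_mul ⟨v, rfl⟩ hw

theorem wedge_wedges {k : ℕ} (v : Fin n → ℂ) (w : Fin k → Fin n → ℂ) :
    wedge k v (wedges w) = wedges (Fin.cons v w : Fin (k + 1) → Fin n → ℂ) := by
  apply Subtype.ext
  change ExteriorAlgebra.ι ℂ v * ExteriorAlgebra.ιMulti ℂ k w = ExteriorAlgebra.ιMulti ℂ (k + 1) _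
  rw [ExteriorAlgebra.ιMulti_succ_apply]
  rfl

theorem wedge_add {k : ℕ} (u v : Fin n → ℂ) : wedge k (u + v) = wedge k u + wedge k v := by
  apply LinearMap.ext
  intro w
  apply Subtype.ext
  change ExteriorAlgebra.ι ℂ (u + v) * w.1 =
    ExteriorAlgebra.ι ℂ u * w.1 + ExteriorAlgebra.ι ℂ v * w.1
  rw [map_add, add_mul]

theorem wedge_smul {k : ℕ} (c : ℂ) (v : Fin n → ℂ) : wedge k (c • v) = c • wedge k v := by
  apply LinearMap.ext
  intro w
  apply Subtype.ext
  change ExteriorAlgebra.ι ℂ (c • v) * w.1 = c • (ExteriorAlgebra.ι ℂ v * w.1)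
  rw [map_smul, smul_mul_assoc]

theorem wedge_anticomm {k : ℕ} (u v : Fin n → ℂ) (w : Vd n k) :
    wedge (k + 1) u (wedge k v w) = - wedge (k + 1) v (wedge k u w) := by
  apply Subtype.ext
  change ExteriorAlgebra.ι ℂ u * (ExteriorAlgebra.ι ℂ v * w.1) =
    - (ExteriorAlgebra.ι ℂ v * (ExteriorAlgebra.ι ℂ u * w.1))
  rw [← mul_assoc, ← mul_assoc, ← neg_mul]
  congr 1
  exact eq_neg_of_add_eq_zero_left (ExteriorAlgebra.ι_add_mul_swap u v)

/-- Linear maps out of `⋀^{k+1}` are determined by their values on the `v ∧ w`. -/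
theorem Vd_succ_ext {k : ℕ} {M : Type*} [AddCommGroup M] [Module ℂ M]
    {f g : Vd n (k + 1) →ₗ[ℂ] M} (h : ∀ v w, f (wedge k v w) = g (wedge k v w)) : f = g := by
  apply Vd_ext
  intro v
  have := h (v 0) (wedges (Fin.tail v))
  rwa [wedge_wedges, Fin.cons_self_tail] at this

/-- The multilinear map `(v_1, …, v_k) ↦ ∑_i v_1 ∧ ⋯ ∧ X v_i ∧ ⋯ ∧ v_k`. -/
def derMulti (k : ℕ) (X : gl n) : MultilinearMap ℂ (fun _ : Fin k => Fin n → ℂ) (Vd n k) :=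
  ∑ i : Fin k, (wedges (n := n) (k := k)).toMultilinearMap.compLinearMap
    (Function.update (fun _ => LinearMap.id) i (Matrix.mulVecLin X))

theorem derMulti_apply {k : ℕ} (X : gl n) (v : Fin k → Fin n → ℂ) :
    derMulti k X v = ∑ i, wedges (Function.update v i (X.mulVec (v i))) := by
  rw [derMulti, sum_apply]
  refine Finset.sum_congr rfl fun i _ => ?_
  rw [MultilinearMap.compLinearMap_apply]
  change wedges _ = _
  congr 1
  funext l
  by_cases h : l = i
  · subst h; simp
  · simp [h]

/-- The map `derMulti` is alternating. -/
def derAlt (k : ℕ) (X : gl n) : (Fin n → ℂ) [⋀^Fin k]→ₗ[ℂ] Vd n k where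
  toMultilinearMap := derMulti k X
  map_eq_zero_of_eq' := by
    intro v a b hab hne
    change derMulti k X v = 0
    rw [derMulti_apply, Finset.sum_eq_add a b hne]
    · have h : Function.update v b (X.mulVec (v b)) =
          Function.update v a (X.mulVec (v a)) ∘ Equiv.swap a b := by
        funext l
        by_cases hb : l = b
        · subst hb; simp [hab]
        · by_cases ha : l = a
          · subst ha; simp [hne, hne.symm, hab]
          · simp [ha, hb, Equiv.swap_apply_of_ne_of_ne]
      rw [h, AlternatingMap.map_swap _ _ hne, add_neg_cancel]
    · intro c _ hc
      apply AlternatingMap.map_eq_zero_of_eq _ _ _ hne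
      simp [hc.1.symm, hc.2.symm, hab]
    · simp
    · simp

theorem derAlt_apply {k : ℕ} (X : gl n) (v : Fin k → Fin n → ℂ) :
    derAlt k X v = ∑ i, wedges (Function.update v i (X.mulVec (v i))) :=
  derMulti_apply X v

/-- The action of `X ∈ 𝔤𝔩_n` on `⋀^k(ℂ^n)`. -/
def der (k : ℕ) (X : gl n) : Vd n k →ₗ[ℂ] Vd n k :=
  exteriorPower.alternatingMapLinearEquiv (derAlt k X)

/-- `X (v_1 ∧ ⋯ ∧ v_k) = ∑_i v_1 ∧ ⋯ ∧ X v_i ∧ ⋯ ∧ v_k`. -/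
theorem der_wedges {k : ℕ} (X : gl n) (v : Fin k → Fin n → ℂ) :
    der k X (wedges v) = ∑ i, wedges (Function.update v i (X.mulVec (v i))) := by
  rw [← derAlt_apply]
  exact exteriorPower.alternatingMapLinearEquiv_apply_ιMulti _ _

theorem der_zero (X : gl n) (w : Vd n 0) : der 0 X w = 0 := by
  have : der 0 X = 0 := Vd_ext fun v => by rw [der_wedges]; simp
  rw [this, LinearMap.zero_apply]

theorem der_wedge {k : ℕ} (X : gl n) (v : Fin n → ℂ) (w : Vd n k) :
    der (k + 1) X (wedge k v w) = wedge k (X.mulVec v) w + wedge k v (der k X w) := by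
  have : der (k + 1) X ∘ₗ wedge k v = wedge k (X.mulVec v) + wedge k v ∘ₗ der k X := by
    apply Vd_ext
    intro w
    rw [LinearMap.comp_apply, LinearMap.add_apply, LinearMap.comp_apply, wedge_wedges, der_wedges,
      der_wedges, Fin.sum_univ_succ, wedge_wedges, map_sum]
    congr 1
    · rw [Fin.cons_zero, Fin.update_cons_zero]
    · refine Finset.sum_congr rfl fun i _ => ?_
      rw [wedge_wedges, Fin.cons_succ, Fin.cons_update]
  exact congr($this w)

theorem der_add {k : ℕ} (X Y : gl n) (w : Vd n k) : der k (X + Y) w = der k X w + der k Y w := by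
  induction k with
  | zero => simp [der_zero]
  | succ k ih =>
    have : der (k + 1) (X + Y) = der (k + 1) X + der (k + 1) Y := by
      apply Vd_succ_ext
      intro v w
      simp only [LinearMap.add_apply, der_wedge, ih, Matrix.add_mulVec, wedge_add, map_add]
      abel
    rw [this, LinearMap.add_apply]

theorem der_smul {k : ℕ} (c : ℂ) (X : gl n) (w : Vd n k) : der k (c • X) w = c • der k X w := by
  induction k with
  | zero => simp [der_zero]
  | succ k ih =>
    have : der (k + 1) (c • X) = c • der (k + 1) X := by
      apply Vd_succ_ext
      intro v w
      simp only [LinearMap.smul_apply, der_wedge, ih, Matrix.smul_mulVec, wedge_smul, map_smul,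
        smul_add]
    rw [this, LinearMap.smul_apply]

theorem der_comm {k : ℕ} (X Y : gl n) (w : Vd n k) :
    der k (X * Y - Y * X) w + der k Y (der k X w) = der k X (der k Y w) := by
  induction k with
  | zero => simp [der_zero]
  | succ k ih =>
    have : der (k + 1) (X * Y - Y * X) + der (k + 1) Y ∘ₗ der (k + 1) X =
        der (k + 1) X ∘ₗ der (k + 1) Y := by
      apply Vd_succ_ext
      intro v w
      have h1 : wedge k ((X * Y - Y * X).mulVec v) w =
          wedge k (X.mulVec (Y.mulVec v)) w - wedge k (Y.mulVec (X.mulVec v)) w := by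
        rw [eq_sub_iff_add_eq, ← LinearMap.add_apply, ← wedge_add, Matrix.sub_mulVec,
          Matrix.mulVec_mulVec, Matrix.mulVec_mulVec, sub_add_cancel]
      simp only [LinearMap.add_apply, LinearMap.comp_apply, der_wedge, map_add, ← ih w, h1]
      abel
    exact congr($this w)

end Ext

section

attribute [local instance] LieRing.ofAssociativeRing

instance (n k : ℕ) : LieRingModule (gl n) (Vd n k) where
  bracket X w := der k X w
  add_lie := der_add
  lie_add X := map_add (der k X)
  leibniz_lie X Y w := (der_comm X Y w).symm

instance (n k : ℕ) : LieModule ℂ (gl n) (Vd n k) where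
  smul_lie := der_smul
  lie_smul c X := map_smul (der k X) c

theorem gl_lie_def {n k : ℕ} (X : gl n) (w : Vd n k) : ⁅X, w⁆ = der k X w := rfl

end

/-! ### The generalized de Rham complex -/

section DeRham

attribute [local instance] LieRing.ofAssociativeRing

variable {n : ℕ} {P : Type*} [AddCommGroup P] [Module ℂ P] [Module (K n) P]
  [IsScalarTower ℂ (K n) P]

theorem wedge_zero {k : ℕ} : wedge k (0 : Fin n → ℂ) = 0 := by
  have h := wedge_smul (k := k) (0 : ℂ) (0 : Fin n → ℂ)
  rwa [zero_smul, zero_smul] at h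

theorem E_apply {k : ℕ} (i j : Fin n) (w : Vd n k) :
    E (Vd n k) i j w = der k (Matrix.single i j 1) w := rfl

theorem E_wedge {k : ℕ} (i j l : Fin n) (w : Vd n k) :
    E (Vd n (k + 1)) i j (wedge k (Pi.single l 1) w) =
    (if j = l then wedge k (Pi.single i 1) w else 0) +
      wedge k (Pi.single l 1) (E (Vd n k) i j w) := by
  rw [E_apply, der_wedge, E_apply]
  congr 1
  by_cases h : j = l
  · subst h
    rw [if_pos rfl]
    congr 2
    funext a
    simp [Matrix.single_apply, Pi.single_apply, eq_comm]
  · rw [if_neg h]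
    have : (Matrix.single i j (1 : ℂ)).mulVec (Pi.single l 1) = 0 := by
      funext a
      simp [h]
    rw [this, wedge_zero, LinearMap.zero_apply]

/-- `e_l ∧ E_ij w = - e_i ∧ E_lj w`. -/
theorem wedge_E {k : ℕ} (i j l : Fin n) (w : Vd n k) :
    wedge k (Pi.single l 1) (E (Vd n k) i j w) =
      - wedge k (Pi.single i 1) (E (Vd n k) l j w) := by
  induction k with
  | zero => simp [E_apply, der_zero]
  | succ k ih =>
    have : wedge (k + 1) (Pi.single l 1) ∘ₗ E (Vd n (k + 1)) i j =
        - (wedge (k + 1) (Pi.single i 1) ∘ₗ E (Vd n (k + 1)) l j) := by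
      apply Vd_succ_ext
      intro v w
      simp only [LinearMap.comp_apply, LinearMap.neg_apply, E_apply, der_wedge, map_add]
      simp only [← E_apply]
      rw [wedge_anticomm (Pi.single l 1) v, wedge_anticomm (Pi.single i 1) v, ih]
      have h : ∀ a : Fin n, (Matrix.single a j (1 : ℂ)).mulVec v = v j • Pi.single a 1 := by
        intro a
        funext b
        simp [Matrix.single_mulVec, Function.update_apply, Pi.single_apply]
      rw [h, h, wedge_smul, wedge_smul, LinearMap.smul_apply, LinearMap.smul_apply, map_smul,
        map_smul, wedge_anticomm (Pi.single l 1) (Pi.single i 1), map_neg, smul_neg]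
      abel
    exact congr($this w)

variable (n P) in
/-- The linear map `p ⊗ w ↦ ∑_i ∂_i p ⊗ (e_i ∧ w)`. -/
def dOp (k : ℕ) : P ⊗[ℂ] Vd n k →ₗ[ℂ] P ⊗[ℂ] Vd n (k + 1) :=
  ∑ i, TensorProduct.map (actP n P (pdK i)) (wedge k (Pi.single i 1))

theorem dOp_tmul {k : ℕ} (p : P) (w : Vd n k) :
    dOp n P k (p ⊗ₜ[ℂ] w) = ∑ i, (pdK i • p) ⊗ₜ[ℂ] wedge k (Pi.single i 1) w := by
  rw [dOp, LinearMap.sum_apply]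
  rfl

theorem actF_tmul {V : Type*} [AddCommGroup V] [Module ℂ V] [LieRingModule (gl n) V]
    [LieModule ℂ (gl n) V] (X : W n) (p : P) (v : V) :
    actF n P V X (p ⊗ₜ[ℂ] v) = (WtoK n X • p) ⊗ₜ[ℂ] v +
      ∑ i, ∑ j, (mulK n (pd i (vcoef X j)) • p) ⊗ₜ[ℂ] E V i j v := by
  change (opT (WtoK n X) 1 + opM (jac X) : Module.End ℂ (P ⊗[ℂ] V)) (p ⊗ₜ[ℂ] v) = _
  rw [LinearMap.add_apply, opM]
  simp only [LinearMap.sum_apply]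
  rfl

theorem pdK_WtoK (l : Fin n) (X : W n) :
    pdK l * WtoK n X = WtoK n X * pdK l + ∑ j, mulK n (pd l (vcoef X j)) * pdK j := by
  apply K_ext
  intro r
  rw [add_smul, mul_smul, mul_smul, Finset.sum_smul]
  simp only [mul_smul, WtoK_apply_smul, pdK_smul, mulK_smul]
  rw [W_apply X (mon r), W_apply X (pd l (mon r)), map_sum, ← Finset.sum_add_distrib]
  refine Finset.sum_congr rfl fun j _ => ?_
  rw [Derivation.leibniz, smul_eq_mul, smul_eq_mul, pd_comm]
  ring

theorem pdK_mulK (l : Fin n) (a : A n) :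
    pdK l * mulK n a = mulK n a * pdK l + mulK n (pd l a) := WtoK_mul (pd l) a

theorem sum_rot {M : Type*} [AddCommGroup M] (f : Fin n → Fin n → Fin n → M) :
    ∑ l, ∑ i, ∑ j, f l i j = ∑ i, ∑ j, ∑ l, f l i j := by
  rw [Finset.sum_comm]
  refine Finset.sum_congr rfl fun i _ => ?_
  rw [Finset.sum_comm]

theorem sum_antisymm {M : Type*} [AddCommGroup M] [Module ℂ M] (f : Fin n → Fin n → Fin n → M)
    (h : ∀ i j l, f i j l = - f l j i) : ∑ i, ∑ j, ∑ l, f i j l = 0 := by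
  have hS : ∑ i, ∑ j, ∑ l, f i j l = - ∑ i, ∑ j, ∑ l, f i j l := by
    have h1 : ∑ i, ∑ j, ∑ l, f i j l = ∑ i, ∑ j, ∑ l, f l j i := by
      rw [Finset.sum_comm]
      conv_rhs => rw [Finset.sum_comm]
      refine Finset.sum_congr rfl fun j _ => ?_
      rw [Finset.sum_comm]
    conv_lhs => rw [h1]
    simp only [← Finset.sum_neg_distrib]
    refine Finset.sum_congr rfl fun i _ => Finset.sum_congr rfl fun j _ =>
      Finset.sum_congr rfl fun l _ => h l j i
  have h2 : (2 : ℂ) • ∑ i, ∑ j, ∑ l, f i j l = 0 := by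
    rw [two_smul]
    nth_rewrite 2 [hS]
    exact add_neg_cancel _
  exact (smul_eq_zero.mp h2).resolve_left two_ne_zero

theorem dOp_actF (k : ℕ) (X : W n) :
    dOp n P k ∘ₗ actF n P (Vd n k) X = actF n P (Vd n (k + 1)) X ∘ₗ dOp n P k := by
  apply TensorProduct.ext'
  intro p w
  rw [LinearMap.comp_apply, LinearMap.comp_apply]
  have hl : dOp n P k (actF n P (Vd n k) X (p ⊗ₜ[ℂ] w)) =
      ∑ l, ((pdK l * WtoK n X) • p) ⊗ₜ[ℂ] wedge k (Pi.single l 1) w +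
        ∑ i, ∑ j, ∑ l, ((pdK l * mulK n (pd i (vcoef X j))) • p) ⊗ₜ[ℂ]
          wedge k (Pi.single l 1) (E (Vd n k) i j w) := by
    rw [actF_tmul]
    simp only [map_add, map_sum, dOp_tmul, mul_smul]
  have hr : actF n P (Vd n (k + 1)) X (dOp n P k (p ⊗ₜ[ℂ] w)) =
      ∑ l, ((WtoK n X * pdK l) • p) ⊗ₜ[ℂ] wedge k (Pi.single l 1) w +
        ∑ i, ∑ j, ∑ l, ((mulK n (pd i (vcoef X j)) * pdK l) • p) ⊗ₜ[ℂ]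
          E (Vd n (k + 1)) i j (wedge k (Pi.single l 1) w) := by
    rw [dOp_tmul]
    simp only [map_sum, actF_tmul, mul_smul, Finset.sum_add_distrib]
    rw [sum_rot]
  have h0 : (∑ i, ∑ j, ∑ l, (mulK n (pd l (pd i (vcoef X j))) • p) ⊗ₜ[ℂ]
      wedge k (Pi.single l 1) (E (Vd n k) i j w) : P ⊗[ℂ] Vd n (k + 1)) = 0 := by
    apply sum_antisymm
    intro i j l
    rw [wedge_E, pd_comm, TensorProduct.tmul_neg]
  have h1 : (∑ l, ∑ j, (((mulK n (pd l (vcoef X j)) * pdK j : K n)) • p) ⊗ₜ[ℂ]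
        wedge k (Pi.single l 1) w : P ⊗[ℂ] Vd n (k + 1)) =
      ∑ i, ∑ j, ∑ l, ((mulK n (pd i (vcoef X j)) * pdK l) • p) ⊗ₜ[ℂ]
        (if j = l then wedge k (Pi.single i 1) w else 0) := by
    simp only [TensorProduct.tmul_ite]
    simp
  rw [hl, hr]
  simp only [pdK_WtoK, pdK_mulK, E_wedge, add_smul, TensorProduct.add_tmul,
    TensorProduct.tmul_add, Finset.sum_add_distrib, Finset.sum_smul, TensorProduct.sum_tmul]
  rw [h0, h1]
  abel

variable (n P) in
/-- The differential `d_k(p ⊗ w) = ∑_i ∂_i p ⊗ (e_i ∧ w)`, a homomorphism of `W_n`-modules. -/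
def d (k : ℕ) : F n P (Vd n k) →ₗ⁅ℂ, W n⁆ F n P (Vd n (k + 1)) where
  toLinearMap := (dOp n P k : P ⊗[ℂ] Vd n k →ₗ[ℂ] P ⊗[ℂ] Vd n (k + 1))
  map_lie' := by
    intro X m
    exact congr($(dOp_actF k X) m)

/-- A `W_n`-submodule, regarded as an `𝕊_n`-submodule. -/
def restrictS {M : Type*} [AddCommGroup M] [Module ℂ M] [LieRingModule (W n) M]
    (N : LieSubmodule ℂ (W n) M) : LieSubmodule ℂ (S n) M where
  toSubmodule := N.toSubmodule
  lie_mem := fun h => N.lie_mem h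

variable (n P) in
/-- `𝓛_n(P, 0) = 0`, and `𝓛_n(P, k)` is the image of `d_{k-1}` for `k ≥ 1`, as `W_n`-submodules. -/
def LW : (k : ℕ) → LieSubmodule ℂ (W n) (F n P (Vd n k))
  | 0 => ⊥
  | k + 1 => (d n P k).range

variable (n P) in
/-- `𝓛_n(P, k)` as an `𝕊_n`-submodule of `𝓕(P, V(δ_k))`. -/
def L (k : ℕ) : LieSubmodule ℂ (S n) (F n P (Vd n k)) := restrictS (LW n P k)

variable (n P) in
/-- The `𝕊_n`-submodule `{y | W_n y ⊆ 𝓛_n(P, k)}` of `𝓕(P, V(δ_k))`. -/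
def Ltilde (k : ℕ) : LieSubmodule ℂ (S n) (F n P (Vd n k)) where
  carrier := {y | ∀ X : W n, ⁅X, y⁆ ∈ L n P k}
  add_mem' := by
    intro a b ha hb X
    rw [lie_add]
    exact add_mem (ha X) (hb X)
  zero_mem' := by
    intro X
    rw [lie_zero]
    exact zero_mem _
  smul_mem' := by
    intro c a ha X
    rw [lie_smul]
    exact (L n P k).smul_mem c (ha X)
  lie_mem := by
    intro s y hy X
    exact (LW n P k).lie_mem (hy s)

end DeRham

/-- The subspace `P' ⊗ V` of `𝓕(P, V) = P ⊗ V`, for a subspace `P'` of `P`. -/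
def tensorSub (n : ℕ) {P : Type*} [AddCommGroup P] [Module ℂ P] (P' : Submodule ℂ P) (V : Type*)
    [AddCommGroup V] [Module ℂ V] : Submodule ℂ (F n P V) :=
  (Submodule.span ℂ {y | ∃ p ∈ P', ∃ v : V, y = p ⊗ₜ[ℂ] v} : Submodule ℂ (P ⊗[ℂ] V))

/-! ### Simple submodules and direct sums -/

section General

variable (L₀ : Type*) [LieRing L₀] [LieAlgebra ℂ L₀]

/-- The subspace `U` of `M` is a simple submodule of `M`, and it is the only one. -/
def IsUniqueSimpleSubmodule {M : Type*} [AddCommGroup M] [Module ℂ M] [LieRingModule L₀ M]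
    [LieModule ℂ L₀ M] (U : Submodule ℂ M) : Prop :=
  ∃ N : LieSubmodule ℂ L₀ M, N.toSubmodule = U ∧ LieModule.IsIrreducible ℂ L₀ N ∧
    ∀ N' : LieSubmodule ℂ L₀ M, LieModule.IsIrreducible ℂ L₀ N' → N' = N

variable (M N : Type*) [AddCommGroup M] [Module ℂ M] [LieRingModule L₀ M] [LieModule ℂ L₀ M]
  [AddCommGroup N] [Module ℂ N] [LieRingModule L₀ N] [LieModule ℂ L₀ N]

/-- The direct sum of two Lie modules, with the componentwise action. -/
instance prodLieRingModule : LieRingModule L₀ (M × N) where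
  bracket x m := (⁅x, m.1⁆, ⁅x, m.2⁆)
  add_lie x y m := by ext <;> simp
  lie_add x m m' := by ext <;> simp
  leibniz_lie x y m := by ext <;> simp

instance prodLieModule : LieModule ℂ L₀ (M × N) where
  smul_lie c x m := by ext <;> simp [Bracket.bracket]
  lie_smul c x m := by ext <;> simp [Bracket.bracket]

end General

end DivZeroTorus

end

open DivZeroTorus

open scoped TensorProduct

noncomputable section

set_option linter.unusedSectionVars false

namespace DivZeroTorus

/-! Everything rests on products of two divergence zero fields. Such a product is an element of the
Weyl algebra that need not be a combination of vector fields, and suitable combinations of products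
yield operators with an arbitrary monomial `x^t` in the middle. Since `P` is simple over `𝒦_n`, an
arbitrary monomial gives access to all of `P`.

Degree 0. Here `𝓕(P, V(δ_0))` is `P` with `𝕊_n` acting through `𝒦_n`. When `(u|r) = 0`, `x^r`
commutes with `∂_u`, so `𝕊_n P ⊆ 𝔥P`. Conversely, a stable subspace `N` is preserved by all `∂_a x^t
∂_a` (`dK_xK_dK_smul_mem`), and hence contains `𝔥P` once some `v` in `N` has `∂_a v ≠ 0`
(`hP_le_of_stable`). A nonzero vector killed by `𝔥` forces `P ≅ A_n` (`exists_equiv_of_killed`), and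
taking the constant coefficient shows that `𝔥P` contains no such vector (`eq_zero_of_mem_hP`). This
settles degree 0. Degree 1 follows because `𝓛_n(P, 1)` is the quotient of `P` by the vectors killed
by `𝔥`; the section on equivariant maps treats the two together.

Degrees `2` to `n - 1`. Let `N` be a nonzero stable space of closed forms. A second difference of
products of two fields puts `d(x^t m ∧ ι_u ι_{u'} v)` in `N` for every `t` (`d_xK_ew_io_io_mem`).
The forms `z` with `d(𝒦_n z) ⊆ N` make up a `𝒦_n`-submodule, which is nonzero by the previous remark
and stable under `𝔤𝔩_n`; by simplicity of `P` it is everything (`eq_top_of_gl_stable`). So `N`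
contains all exact forms (`d_mem_of_stable`), which gives simplicity of `𝓛_n(P, k)`. In degree `n`,
divergence zero fields again act through a simple `𝒦_n`-module, so the degree 0 argument applies.

Reducibility of `𝓕(P, V(δ_k))` comes from `d ∘ d = 0` together with `d ≠ 0`. For maximality of
`𝓛̃_n(P, k)`, Cartan's formula places the closed forms inside it; a larger submodule has nonzero
image under `d` in the simple module `𝓛_n(P, k+1)`, hence full image, and it contains the kernel of
`d`. When `k = n - 1` this needs simplicity in the top degree. -/

theorem pair_single {n : ℕ} (i : Fin n) (r : Fin n → ℤ) : pair (Pi.single i 1) r = r i := by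
  simp [pair, Pi.single_apply]

theorem pair_neg_right {n : ℕ} (u : Fin n → ℂ) (r : Fin n → ℤ) : pair u (-r) = -pair u r := by
  simp [pair]

theorem pair_zero_right {n : ℕ} (u : Fin n → ℂ) : pair u (0 : Fin n → ℤ) = 0 := by
  simp [pair]

theorem pair_smul_left {n : ℕ} (a : ℂ) (u : Fin n → ℂ) (r : Fin n → ℤ) :
    pair (a • u) r = a * pair u r := by
  simp [pair, Finset.mul_sum, mul_assoc]

theorem pair_sub_left {n : ℕ} (u v : Fin n → ℂ) (r : Fin n → ℤ) :
    pair (u - v) r = pair u r - pair v r := by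
  simp [pair, sub_mul, Finset.sum_sub_distrib]

theorem pair_add_left {n : ℕ} (u v : Fin n → ℂ) (r : Fin n → ℤ) :
    pair (u + v) r = pair u r + pair v r := by
  simp [pair, add_mul, Finset.sum_add_distrib]

theorem pair_sub_right {n : ℕ} (u : Fin n → ℂ) (r s : Fin n → ℤ) :
    pair u (r - s) = pair u r - pair u s := by
  rw [sub_eq_add_neg, pair_add, pair_neg_right, sub_eq_add_neg]

/-! ### Generators of the Weyl algebra -/

/-- The monomial `x^r` in `𝒦_n`. -/
def xK {n : ℕ} (r : Fin n → ℤ) : K n := mulK n (mon r)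

/-- The constant vector field `∑ u_i ∂_i` in `𝒦_n`. -/
def dK {n : ℕ} (u : Fin n → ℂ) : K n := ∑ i, u i • pdK i

theorem dK_single {n : ℕ} (i : Fin n) : dK (Pi.single i 1) = pdK i := by
  simp [dK, Pi.single_apply]

theorem dK_add {n : ℕ} (u v : Fin n → ℂ) : dK (u + v) = dK u + dK v := by
  simp [dK, add_smul, Finset.sum_add_distrib]

theorem dK_sub {n : ℕ} (u v : Fin n → ℂ) : dK (u - v) = dK u - dK v := by
  simp [dK, sub_smul, Finset.sum_sub_distrib]

theorem xK_zero {n : ℕ} : xK (0 : Fin n → ℤ) = 1 := by rw [xK, mon_zero, map_one]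

theorem xK_mul {n : ℕ} (r s : Fin n → ℤ) : xK r * xK s = xK (r + s) := by
  rw [xK, xK, xK, ← map_mul, mon_mul]

theorem WtoK_D {n : ℕ} (u : Fin n → ℂ) (r : Fin n → ℤ) : WtoK n (D u r) = xK r * dK u := by
  rw [D, WtoK_smul, map_sum, xK, dK]
  simp only [map_smul, WtoK_pd]

theorem dK_xK {n : ℕ} (u : Fin n → ℂ) (r : Fin n → ℤ) :
    dK u * xK r = xK r * dK u + pair u r • xK r := by
  simp only [dK, Finset.sum_mul, Finset.mul_sum, pair, Finset.sum_smul, ← Finset.sum_add_distrib]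
  refine Finset.sum_congr rfl fun i _ => ?_
  rw [smul_mul_assoc, mul_smul_comm, mul_smul, ← smul_add, xK, pdK_mulK, pd_mon, map_smul]

theorem pdK_mul_comm {n : ℕ} (i j : Fin n) : pdK i * pdK j = (pdK j * pdK i : K n) := by
  apply K_ext
  intro r
  rw [mul_smul, mul_smul, pdK_smul, pdK_smul, pdK_smul, pdK_smul, pd_comm]

/-- Induction over the elements of `𝒦_n` along its generators. -/
theorem K_induction {n : ℕ} {p : K n → Prop} (hx : ∀ r, p (xK r)) (hd : ∀ i, p (pdK i))
    (hadd : ∀ y z, p y → p z → p (y + z)) (hmul : ∀ y z, p y → p z → p (y * z))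
    (hsmul : ∀ (c : ℂ) y, p y → p (c • y)) (y : K n) : p y := by
  have hA : ∀ a : A n, p (mulK n a) := by
    intro a
    have ha : a ∈ Submodule.span ℂ (Set.range (monBasis n)) := by
      rw [(monBasis n).span_eq]; trivial
    induction ha using Submodule.span_induction with
    | mem b hb =>
      obtain ⟨r, rfl⟩ := hb
      exact hx r
    | zero =>
      have := hsmul 0 _ (hx 0)
      rwa [zero_smul, ← map_zero (mulK n)] at this
    | add a b _ _ ha hb => rw [map_add]; exact hadd _ _ ha hb
    | smul c a _ ha => rw [map_smul]; exact hsmul _ _ ha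
  obtain ⟨y, hy⟩ := y
  induction hy using Algebra.adjoin_induction with
  | mem z hz =>
    rcases hz with ⟨a, rfl⟩ | ⟨i, rfl⟩
    · exact hA a
    · exact hd i
  | algebraMap c =>
    have := hsmul c _ (hx 0)
    rw [xK_zero, ← Algebra.algebraMap_eq_smul_one] at this
    exact this
  | add y z _ _ hy hz => exact hadd _ _ hy hz
  | mul y z _ _ hy hz => exact hmul _ _ hy hz

/-! ### Modules over the Weyl algebra -/

section Module

variable {n : ℕ} {Q : Type*} [AddCommGroup Q] [Module ℂ Q] [Module (K n) Q]
  [IsScalarTower ℂ (K n) Q]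

theorem dK_smul_xK_smul (u : Fin n → ℂ) (r : Fin n → ℤ) (z : Q) :
    dK u • (xK r : K n) • z = (xK r : K n) • (dK u • z + pair u r • z) := by
  rw [← mul_smul, dK_xK, add_smul, mul_smul, smul_assoc, smul_add, smul_comm (xK r) (pair u r)]

theorem xK_smul_xK_smul (r s : Fin n → ℤ) (z : Q) :
    (xK r : K n) • (xK s : K n) • z = (xK (r + s) : K n) • z := by
  rw [← mul_smul, xK_mul]

theorem xK_neg_smul_xK_smul (r : Fin n → ℤ) (z : Q) : (xK (-r) : K n) • (xK r : K n) • z = z := by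
  rw [xK_smul_xK_smul, neg_add_cancel, xK_zero, one_smul]

theorem dK_smul_eq_sum (u : Fin n → ℂ) (z : Q) : dK u • z = ∑ i, u i • (pdK i : K n) • z := by
  simp [dK, Finset.sum_smul]

variable (n) in
/-- A subspace stable under the `x^r` and the `∂_i` is a `𝒦_n`-submodule. -/
def toKSubmodule (N : Submodule ℂ Q) (hx : ∀ r, ∀ z ∈ N, (xK r : K n) • z ∈ N)
    (hd : ∀ i, ∀ z ∈ N, (pdK i : K n) • z ∈ N) : Submodule (K n) Q where
  carrier := N
  add_mem' := N.add_mem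
  zero_mem' := N.zero_mem
  smul_mem' := by
    intro y
    induction y using K_induction with
    | hx r => exact hx r _
    | hd i => exact hd i _
    | hadd y z hy hz => intro v hv; rw [add_smul]; exact N.add_mem (hy hv) (hz hv)
    | hmul y z hy hz => intro v hv; rw [mul_smul]; exact hy (hz hv)
    | hsmul c y hy => intro v hv; rw [smul_assoc]; exact N.smul_mem c (hy hv)

theorem hP_le_iff {N : Submodule ℂ Q} :
    hP n Q ≤ N ↔ ∀ (i : Fin n) (q : Q), (pdK i : K n) • q ∈ N := by
  rw [hP, Submodule.span_le]
  constructor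
  · intro h i q
    exact h ⟨i, q, rfl⟩
  · rintro h _ ⟨i, q, rfl⟩
    exact h i q

theorem pdK_smul_mem_hP (i : Fin n) (q : Q) : (pdK i : K n) • q ∈ hP n Q :=
  Submodule.subset_span ⟨i, q, rfl⟩

theorem dK_smul_mem_hP (u : Fin n → ℂ) (q : Q) : dK u • q ∈ hP n Q := by
  rw [dK_smul_eq_sum]
  exact sum_mem fun i _ => Submodule.smul_mem _ _ (pdK_smul_mem_hP i q)

/-- Divergence zero vector fields map `P` into `𝔥P`. -/
theorem D_smul_mem_hP {u : Fin n → ℂ} {r : Fin n → ℤ} (h : pair u r = 0) (q : Q) :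
    WtoK n (D u r) • q ∈ hP n Q := by
  have : WtoK n (D u r) • q = dK u • (xK r : K n) • q := by
    rw [WtoK_D, ← mul_smul, dK_xK, h, zero_smul, add_zero]
  rw [this]
  exact dK_smul_mem_hP _ _

/-- If `N` is stable under the `∂_i` and `g` commutes with them, then a subspace containing all
`x^t g(v)` with `v ∈ N` contains all `y g(v)` with `y ∈ 𝒦_n` and `v ∈ N`. -/
theorem smul_mem_of_xK_smul_mem {Q' : Type*} [AddCommGroup Q'] [Module ℂ Q'] [Module (K n) Q']
    {N : Submodule ℂ Q'} {B : Submodule ℂ Q} {g : Q' → Q}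
    (hN : ∀ i, ∀ v ∈ N, (pdK i : K n) • v ∈ N)
    (hg : ∀ i v, g ((pdK i : K n) • v) = (pdK i : K n) • g v)
    (hB : ∀ t, ∀ v ∈ N, (xK t : K n) • g v ∈ B) (y : K n) {v : Q'} (hv : v ∈ N) :
    y • g v ∈ B := by
  -- The span of all `x^t g(w)` is already a `𝒦_n`-submodule: moving `∂_i` past `x^t` costs a
  -- scalar, and `∂_i g(w) = g(∂_i w)` stays in the family.
  let Q₀ : Submodule ℂ Q := Submodule.span ℂ {q | ∃ w ∈ N, ∃ t, q = (xK t : K n) • g w}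
  have hQ₀ : ∀ w ∈ N, ∀ t, (xK t : K n) • g w ∈ Q₀ := fun w hw t =>
    Submodule.subset_span ⟨w, hw, t, rfl⟩
  have hx : ∀ r, ∀ z ∈ Q₀, (xK r : K n) • z ∈ Q₀ := by
    intro r z hz
    induction hz using Submodule.span_induction with
    | mem q hq =>
      obtain ⟨w, hw, t, rfl⟩ := hq
      rw [xK_smul_xK_smul]
      exact hQ₀ w hw _
    | zero => rw [smul_zero]; exact zero_mem _
    | add y z _ _ hy hz => rw [smul_add]; exact add_mem hy hz
    | smul c y _ hy => rw [smul_comm]; exact Submodule.smul_mem _ _ hy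
  have hd : ∀ i, ∀ z ∈ Q₀, (pdK i : K n) • z ∈ Q₀ := by
    intro i z hz
    induction hz using Submodule.span_induction with
    | mem q hq =>
      obtain ⟨w, hw, t, rfl⟩ := hq
      rw [← dK_single i, dK_smul_xK_smul, smul_add, smul_comm (xK t : K n) (pair _ t), dK_single,
        ← hg]
      exact add_mem (hQ₀ _ (hN i w hw) t) (Submodule.smul_mem _ _ (hQ₀ w hw t))
    | zero => rw [smul_zero]; exact zero_mem _
    | add y z _ _ hy hz => rw [smul_add]; exact add_mem hy hz
    | smul c y _ hy => rw [smul_comm]; exact Submodule.smul_mem _ _ hy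
  have hle : Q₀ ≤ B := by
    rw [Submodule.span_le]
    rintro _ ⟨w, hw, t, rfl⟩
    exact hB t w hw
  have h1 : g v ∈ toKSubmodule n Q₀ hx hd := by
    have := hQ₀ v hv 0
    rwa [xK_zero, one_smul] at this
  exact hle ((toKSubmodule n Q₀ hx hd).smul_mem y h1)

/-! ### Subspaces of a simple `𝒦_n`-module stable under divergence zero vector fields -/

section Stable

variable {N : Submodule ℂ Q}
  (hN : ∀ (u : Fin n → ℂ) (r : Fin n → ℤ), pair u r = 0 → ∀ v ∈ N, WtoK n (D u r) • v ∈ N)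

include hN

theorem dK_smul_mem (u : Fin n → ℂ) {v : Q} (hv : v ∈ N) : dK u • v ∈ N := by
  have := hN u 0 (by simp [pair]) v hv
  rwa [WtoK_D, xK_zero, one_mul] at this

/-- In `𝒦_n` one has `∂_u x^t ∂_u = D(w, t) D(u, 0) - D(w - u, t - m) D(u, m)`: the second product
equals `x^t (∂_w - ∂_u - (u|t)) ∂_u`, because `(w|m) = -(u|t)` and `(u|m) = 0`. The three conditions
on the pairings are also what makes all four fields divergence free. -/
theorem dK_xK_dK_smul_mem {u w : Fin n → ℂ} {m t : Fin n → ℤ} (hum : pair u m = 0)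
    (hwt : pair w t = 0) (hwm : pair w m + pair u t = 0) {v : Q} (hv : v ∈ N) :
    dK u • (xK t : K n) • dK u • v ∈ N := by
  have h1 := hN (w - u) (t - m) (by
    rw [pair_sub_left, pair_sub_right, pair_sub_right]; linear_combination hwt - hwm + hum) _
    (hN u m hum v hv)
  have h2 := hN w t hwt _ (hN u 0 (pair_zero_right u) v hv)
  have key : dK u • (xK t : K n) • dK u • v = WtoK n (D w t) • WtoK n (D u 0) • v -
      WtoK n (D (w - u) (t - m)) • WtoK n (D u m) • v := by
    have h3 : pair w m = - pair u t := by linear_combination hwm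
    simp only [WtoK_D, mul_smul, dK_smul_xK_smul, xK_smul_xK_smul, xK_zero, one_smul,
      sub_add_cancel, dK_sub, sub_smul, hum, h3, ← smul_sub]
    congr 1
    simp only [zero_smul, add_zero, neg_smul]
    abel
  rw [key]
  exact N.sub_mem h2 h1

theorem pdK_xK_pdK_smul_mem (hn : 2 ≤ n) (a : Fin n) (t : Fin n → ℤ) {v : Q} (hv : v ∈ N) :
    (pdK a : K n) • (xK t : K n) • (pdK a : K n) • v ∈ N := by
  have : Nontrivial (Fin n) := Fin.nontrivial_iff_two_le.mpr hn
  obtain ⟨b, hb⟩ := exists_ne a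
  rw [← dK_single]
  -- The choice of `w` is orthogonal to `t` for every `t`, and pairs with `e_b` to `-t_a`. A second
  -- index `b` is where `n ≥ 2` enters.
  refine dK_xK_dK_smul_mem hN (m := Pi.single b 1)
    (w := (t b : ℂ) • Pi.single a 1 - (t a : ℂ) • Pi.single b 1) ?_ ?_ ?_ hv
  · simp [pair_single, hb.symm]
  · simp only [pair_comb, pair_single]; ring
  · simp [pair_comb, pair_single, hb.symm]

/-- Polarization: together with the diagonal operators `∂_a x^t ∂_a` this controls the mixed terms
`∂_b x^t ∂_a`. -/
theorem dK_sub_xK_dK_sub_smul_mem {a b : Fin n} (hab : a ≠ b) (t : Fin n → ℤ) {v : Q}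
    (hv : v ∈ N) : dK (Pi.single a 1 - Pi.single b 1 : Fin n → ℂ) • (xK t : K n) •
      dK (Pi.single a 1 - Pi.single b 1 : Fin n → ℂ) • v ∈ N := by
  refine dK_xK_dK_smul_mem hN (m := Pi.single a 1 + Pi.single b 1)
    (w := (t b : ℂ) • Pi.single a 1 - (t a : ℂ) • Pi.single b 1) ?_ ?_ ?_ hv
  · simp [pair_sub_left, pair_single, hab, hab.symm]
  · simp only [pair_comb, pair_single]; ring
  · simp only [pair_sub_left, pair_smul_left, pair_single, Pi.add_apply, Pi.single_eq_same,
      Pi.single_eq_of_ne hab, Pi.single_eq_of_ne hab.symm]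
    push_cast
    ring

/-- In a simple `𝒦_n`-module, a subspace stable under divergence zero vector fields contains
`𝔥P` as soon as it has a vector not killed by `𝔥`. -/
theorem hP_le_of_stable [IsSimpleModule (K n) Q] (hn : 2 ≤ n) {v : Q} (hv : v ∈ N) {a : Fin n}
    (ha : (pdK a : K n) • v ≠ 0) : hP n Q ≤ N := by
  have hpd : ∀ (i : Fin n), ∀ w ∈ N, (pdK i : K n) • w ∈ N := by
    intro i w hw
    rw [← dK_single]
    exact dK_smul_mem hN _ hw
  -- As `∂_a v ≠ 0` generates the simple module `Q`, every `q` is `y ∂_a v`. Knowing `∂_b x^t ∂_a w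
  -- ∈ N` for all `t` is then enough to get `∂_b Q ⊆ N`.
  have hmem : ∀ {b : Fin n}, (∀ w ∈ N, ∀ t, (pdK b : K n) • (xK t : K n) • (pdK a : K n) • w ∈ N) →
      ∀ q : Q, (pdK b : K n) • q ∈ N := by
    intro b hb q
    obtain ⟨y, rfl⟩ := IsSimpleModule.toSpanSingleton_surjective (K n) ha q
    exact smul_mem_of_xK_smul_mem (g := fun w => (pdK a : K n) • w)
      (B := N.comap (actP n Q (pdK b))) hpd
      (fun i w => by rw [← mul_smul, ← mul_smul, pdK_mul_comm]) (fun t w hw => hb w hw t) y hv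
  have haN := hmem (b := a) fun w hw t => pdK_xK_pdK_smul_mem hN hn a t hw
  rw [hP_le_iff]
  intro b
  by_cases hab : a = b
  · exact hab ▸ haN
  · refine hmem fun w hw t => ?_
    -- Expanding `(∂_a - ∂_b) x^t (∂_a - ∂_b)`, every term except `∂_b x^t ∂_a` is known to map `w`
    -- into `N`; those beginning with `∂_a` do so because `∂_a Q ⊆ N`.
    have h1 := dK_sub_xK_dK_sub_smul_mem hN hab t hw
    have h2 := pdK_xK_pdK_smul_mem hN hn b t hw
    simp only [dK_sub, dK_single, sub_smul, smul_sub] at h1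
    have h3 := N.sub_mem (N.sub_mem (N.add_mem (haN ((xK t : K n) • (pdK a : K n) • w)) h2) h1)
      (haN ((xK t : K n) • (pdK b : K n) • w))
    convert h3 using 1
    abel

end Stable

/-! ### Vectors killed by `𝔥` -/

theorem xK_smul_ne_zero (r : Fin n → ℤ) {v : Q} (hv : v ≠ 0) : (xK r : K n) • v ≠ 0 := by
  intro h
  apply hv
  rw [← xK_neg_smul_xK_smul r v, h, smul_zero]

/-- When `𝔥` kills `v`, each `x^r v` is a joint eigenvector of the commuting operators `∂_i` with
eigenvalues `r_i`, and distinct `r` give distinct weights. -/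
theorem linearIndependent_xK_smul {v : Q} (hv : v ≠ 0) (hd : ∀ i, (pdK i : K n) • v = 0) :
    LinearIndependent ℂ fun r : Fin n → ℤ => (xK r : K n) • v := by
  have hind := Module.End.independent_iInf_maxGenEigenspace_of_forall_mapsTo
    (fun i : Fin n => actP n Q (pdK i)) (by
      intro i j φ
      apply Module.End.mapsTo_maxGenEigenspace_of_comm
      rw [commute_iff_eq, ← map_mul, ← map_mul, pdK_mul_comm])
  have hinj : Function.Injective fun (r : Fin n → ℤ) (i : Fin n) => (r i : ℂ) := by
    intro r s h
    funext i
    exact Int.cast_injective (congr_fun h i)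
  refine (hind.comp hinj).linearIndependent _ (fun r => ?_) fun r => xK_smul_ne_zero r hv
  rw [Function.comp_apply, Submodule.mem_iInf]
  intro i
  apply (Module.End.genEigenspace _ _).mono le_top
  rw [Module.End.mem_genEigenspace_one]
  change (pdK i : K n) • (xK r : K n) • v = (r i : ℂ) • (xK r : K n) • v
  rw [← dK_single, dK_smul_xK_smul, dK_single, hd, zero_add, pair_single, smul_comm]

/-- A nonzero vector of a simple `𝒦_n`-module killed by `𝔥` corresponds to `1` under an
isomorphism with `A_n`. -/
theorem exists_equiv_of_killed [IsSimpleModule (K n) Q] {v : Q} (hv : v ≠ 0)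
    (hd : ∀ i, (pdK i : K n) • v = 0) : ∃ e : A n ≃ₗ[K n] Q, e 1 = v := by
  let f : A n →ₗ[K n] Q :=
    { toFun := fun a => mulK n a • v
      map_add' := fun a b => by rw [map_add, add_smul]
      map_smul' := by
        intro y
        induction y using K_induction with
        | hx r =>
          intro a
          rw [RingHom.id_apply, xK, mulK_smul, map_mul, mul_smul]
        | hd i =>
          intro a
          rw [RingHom.id_apply, pdK_smul, ← mul_smul, pdK_mulK, add_smul, mul_smul, hd, smul_zero,
            zero_add]
        | hadd y z hy hz => intro a; simp only [add_smul, map_add, hy, hz, RingHom.id_apply]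
        | hmul y z hy hz => intro a; rw [mul_smul, hy, hz, RingHom.id_apply, RingHom.id_apply,
            RingHom.id_apply, mul_smul]
        | hsmul c y hy =>
          intro a
          rw [smul_assoc, map_smul, smul_assoc, hy, RingHom.id_apply, RingHom.id_apply,
            smul_assoc] }
  have h1 : f 1 = v := by
    change mulK n 1 • v = v
    rw [map_one, one_smul]
  have hsurj : Function.Surjective f := by
    rw [← LinearMap.range_eq_top]
    refine (eq_bot_or_eq_top _).resolve_left fun h => hv ?_
    rw [LinearMap.range_eq_bot] at h
    rw [← h1, h, LinearMap.zero_apply]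
  have hinj : Function.Injective f := by
    refine LinearMap.injective_of_linearIndependent (f := f.restrictScalars ℂ)
      (v := monBasis n) (monBasis n).span_eq ?_
    exact linearIndependent_xK_smul hv hd
  exact ⟨LinearEquiv.ofBijective f ⟨hinj, hsurj⟩, h1⟩

/-- The constant coefficient of a Laurent polynomial. -/
def constCoeff (n : ℕ) : A n →ₗ[ℂ] ℂ := (monBasis n).coord 0

theorem constCoeff_mon {r : Fin n → ℤ} : constCoeff n (mon r) = if r = 0 then 1 else 0 := by
  rw [constCoeff, ← monBasis_apply, Module.Basis.coord_apply, Module.Basis.repr_self,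
    Finsupp.single_apply]

theorem constCoeff_one : constCoeff n 1 = 1 := by rw [← mon_zero, constCoeff_mon, if_pos rfl]

theorem constCoeff_pd (i : Fin n) (a : A n) : constCoeff n (pd i a) = 0 := by
  have : constCoeff n ∘ₗ ((pd i : W n) : A n →ₗ[ℂ] A n) = 0 := by
    apply A_ext
    intro r
    change constCoeff n (pd i (mon r)) = 0
    rw [pd_mon, map_smul, constCoeff_mon]
    by_cases h : r = 0 <;> simp [h]
  exact congr($this a)

theorem constCoeff_eq_zero_of_mem_hP {a : A n} (ha : a ∈ hP n (A n)) : constCoeff n a = 0 := by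
  have : hP n (A n) ≤ LinearMap.ker (constCoeff n) := hP_le_iff.mpr fun i a => constCoeff_pd i a
  exact this ha

/-- An isomorphism of `𝒦_n`-modules maps `𝔥P` into `𝔥Q`. -/
theorem equiv_mem_hP {Q' : Type*} [AddCommGroup Q'] [Module ℂ Q'] [Module (K n) Q']
    [IsScalarTower ℂ (K n) Q'] (e : Q ≃ₗ[K n] Q') {v : Q} (hv : v ∈ hP n Q) : e v ∈ hP n Q' := by
  have : hP n Q ≤ (hP n Q').comap (e.toLinearMap.restrictScalars ℂ) := by
    rw [hP_le_iff]
    intro i q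
    change e ((pdK i : K n) • q) ∈ hP n Q'
    rw [map_smul]
    exact pdK_smul_mem_hP i _
  exact this hv

/-- No nonzero vector of `𝔥P` is killed by `𝔥`. -/
theorem eq_zero_of_mem_hP [IsSimpleModule (K n) Q] {v : Q} (hv : v ∈ hP n Q)
    (hd : ∀ i, (pdK i : K n) • v = 0) : v = 0 := by
  by_contra h
  -- The isomorphism sends `1` to `v`, but `1` has constant coefficient `1`, whereas everything in
  -- `𝔥A_n` has constant coefficient `0`.
  obtain ⟨e, he⟩ := exists_equiv_of_killed h hd
  have := constCoeff_eq_zero_of_mem_hP (equiv_mem_hP e.symm hv)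
  rw [← he, e.symm_apply_apply, constCoeff_one] at this
  exact one_ne_zero this

theorem exists_pdK_smul_ne_zero [IsSimpleModule (K n) Q] (h : IsEmpty (Q ≃ₗ[K n] A n)) {v : Q}
    (hv : v ≠ 0) : ∃ i, (pdK i : K n) • v ≠ 0 := by
  by_contra! hd
  obtain ⟨e, -⟩ := exists_equiv_of_killed hv hd
  exact h.elim e.symm

/-- A nonzero stable subspace contained in `𝔥P` is `𝔥P`. -/
theorem eq_hP_of_le_hP [IsSimpleModule (K n) Q] (hn : 2 ≤ n) {N : Submodule ℂ Q}
    (hN : ∀ (u : Fin n → ℂ) (r : Fin n → ℤ), pair u r = 0 → ∀ v ∈ N, WtoK n (D u r) • v ∈ N)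
    (hle : N ≤ hP n Q) (h0 : N ≠ ⊥) : N = hP n Q := by
  obtain ⟨v, hv, hv0⟩ := Submodule.exists_mem_ne_zero_of_ne_bot h0
  obtain ⟨i, hi⟩ : ∃ i, (pdK i : K n) • v ≠ 0 := by
    by_contra! hd
    exact hv0 (eq_zero_of_mem_hP (hle hv) hd)
  exact le_antisymm hle (hP_le_of_stable hN hn hv hi)

end Module

/-! ### Contractions on exterior powers -/

section Contraction

variable {n : ℕ}

/-- The linear form `v ↦ ∑ u_i v_i`. -/
def dotForm : (Fin n → ℂ) →ₗ[ℂ] Module.Dual ℂ (Fin n → ℂ) := dotProductBilin ℂ ℂ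

theorem dotForm_apply (u v : Fin n → ℂ) : dotForm u v = u ⬝ᵥ v := rfl

/-- The antiderivation rule gives this by induction on the degree; it is what lets the Clifford
contraction for the zero quadratic form restrict to the graded pieces. -/
theorem contractLeft_mem (f : Module.Dual ℂ (Fin n → ℂ)) :
    ∀ (k : ℕ) {x : ExteriorAlgebra ℂ (Fin n → ℂ)}, x ∈ ⋀[ℂ]^(k + 1) (Fin n → ℂ) →
      CliffordAlgebra.contractLeft f x ∈ ⋀[ℂ]^k (Fin n → ℂ)
  | 0, x, hx => by
    rw [zero_add] at hx
    change x ∈ LinearMap.range (ExteriorAlgebra.ι ℂ) ^ 1 at hx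
    rw [pow_one] at hx
    obtain ⟨v, rfl⟩ := hx
    have : CliffordAlgebra.contractLeft f (ExteriorAlgebra.ι ℂ v) = algebraMap ℂ _ (f v) :=
      CliffordAlgebra.contractLeft_ι _ f v
    rw [this]
    change _ ∈ LinearMap.range (ExteriorAlgebra.ι ℂ) ^ 0
    rw [pow_zero]
    exact Submodule.algebraMap_mem _
  | k + 1, x, hx => by
    change x ∈ LinearMap.range (ExteriorAlgebra.ι ℂ) ^ (k + 1 + 1) at hx
    rw [pow_succ'] at hx
    induction hx using Submodule.mul_induction_on' with
    | mem_mul_mem a ha b hb =>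
      obtain ⟨v, rfl⟩ := ha
      have : CliffordAlgebra.contractLeft f (ExteriorAlgebra.ι ℂ v * b) =
          f v • b - ExteriorAlgebra.ι ℂ v * CliffordAlgebra.contractLeft f b :=
        CliffordAlgebra.contractLeft_ι_mul f v b
      rw [this]
      refine Submodule.sub_mem _ (Submodule.smul_mem _ _ hb) ?_
      change _ ∈ LinearMap.range (ExteriorAlgebra.ι ℂ) ^ (k + 1)
      rw [pow_succ']
      exact Submodule.mul_mem_mul ⟨v, rfl⟩ (contractLeft_mem f k hb)
    | add a _ b _ ha hb => rw [map_add]; exact Submodule.add_mem _ ha hb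

/-- The contraction of `⋀^{k+1}` with the linear form given by `u`. -/
def ctr (k : ℕ) (u : Fin n → ℂ) : Vd n (k + 1) →ₗ[ℂ] Vd n k :=
  (CliffordAlgebra.contractLeft (Q := (0 : QuadraticForm ℂ (Fin n → ℂ))) (dotForm u)).restrict
    (p := ⋀[ℂ]^(k + 1) (Fin n → ℂ)) (q := ⋀[ℂ]^k (Fin n → ℂ)) fun _ hx => contractLeft_mem _ k hx

theorem ctr_add {k : ℕ} (u v : Fin n → ℂ) : ctr k (u + v) = ctr k u + ctr k v := by
  apply LinearMap.ext
  intro w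
  apply Subtype.ext
  change CliffordAlgebra.contractLeft (dotForm (u + v)) w.1 =
    CliffordAlgebra.contractLeft (dotForm u) w.1 + CliffordAlgebra.contractLeft (dotForm v) w.1
  rw [map_add, map_add, LinearMap.add_apply]

theorem ctr_smul {k : ℕ} (c : ℂ) (u : Fin n → ℂ) : ctr k (c • u) = c • ctr k u := by
  apply LinearMap.ext
  intro w
  apply Subtype.ext
  change CliffordAlgebra.contractLeft (dotForm (c • u)) w.1 =
    c • CliffordAlgebra.contractLeft (dotForm u) w.1
  rw [map_smul, map_smul, LinearMap.smul_apply]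

/-- The degree zero case of the antiderivation rule stands apart because a scalar has no contraction
term. -/
theorem ctr_wedge_zero (u v : Fin n → ℂ) (w : Vd n 0) :
    ctr 0 u (wedge 0 v w) = (u ⬝ᵥ v) • w := by
  apply Subtype.ext
  obtain ⟨w, hw⟩ := w
  change CliffordAlgebra.contractLeft (dotForm u) (ExteriorAlgebra.ι ℂ v * w) = (u ⬝ᵥ v) • w
  change w ∈ LinearMap.range (ExteriorAlgebra.ι ℂ) ^ 0 at hw
  rw [pow_zero, Submodule.mem_one] at hw
  obtain ⟨c, rfl⟩ := hw
  refine (CliffordAlgebra.contractLeft_ι_mul (dotForm u) v _).trans ?_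
  have : CliffordAlgebra.contractLeft (dotForm u)
      (algebraMap ℂ (ExteriorAlgebra ℂ (Fin n → ℂ)) c) = 0 :=
    CliffordAlgebra.contractLeft_algebraMap _ (dotForm u) c
  rw [this, mul_zero, sub_zero, dotForm_apply]

theorem ctr_wedge {k : ℕ} (u v : Fin n → ℂ) (w : Vd n (k + 1)) :
    ctr (k + 1) u (wedge (k + 1) v w) = (u ⬝ᵥ v) • w - wedge k v (ctr k u w) :=
  Subtype.ext (CliffordAlgebra.contractLeft_ι_mul (dotForm u) v w.1)

theorem ctr_anticomm {k : ℕ} (u v : Fin n → ℂ) (w : Vd n (k + 2)) :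
    ctr k u (ctr (k + 1) v w) = -ctr k v (ctr (k + 1) u w) :=
  Subtype.ext (CliffordAlgebra.contractLeft_comm (dotForm u) (dotForm v) w.1)

theorem vecMulVec_mulVec_eq (r u v : Fin n → ℂ) :
    (Matrix.vecMulVec r u).mulVec v = (u ⬝ᵥ v) • r := by
  rw [Matrix.vecMulVec_mulVec]
  ext i
  simp [mul_comm]

/-- The rank one matrix `r uᵀ` acts on `⋀^{k+1}` by `w ↦ r ∧ ι_u w`. -/
theorem der_vecMulVec (r u : Fin n → ℂ) :
    ∀ (k : ℕ), der (k + 1) (Matrix.vecMulVec r u) = wedge k r ∘ₗ ctr k u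
  | 0 => by
    apply Vd_succ_ext
    intro v w
    rw [der_wedge, der_zero, map_zero, add_zero, LinearMap.comp_apply, ctr_wedge_zero,
      vecMulVec_mulVec_eq, wedge_smul, LinearMap.smul_apply, map_smul]
  | k + 1 => by
    apply Vd_succ_ext
    intro v w
    rw [der_wedge, der_vecMulVec r u k, LinearMap.comp_apply, LinearMap.comp_apply, ctr_wedge,
      vecMulVec_mulVec_eq, wedge_smul, LinearMap.smul_apply, map_sub, map_smul,
      wedge_anticomm r v, sub_neg_eq_add]

/-- The top exterior power is the last nonzero one. -/
theorem Vd_succ_self_eq_zero (w : Vd n (n + 1)) : w = 0 := by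
  have : (LinearMap.id : Vd n (n + 1) →ₗ[ℂ] Vd n (n + 1)) = 0 := by
    apply Vd_ext
    intro v
    rw [LinearMap.id_apply, LinearMap.zero_apply]
    apply AlternatingMap.map_linearDependent
    intro h
    have := h.fintype_card_le_finrank
    simp at this
  exact congr($this w)

end Contraction

/-! ### The `𝒦_n`-module `P ⊗ V` -/

section KModule

attribute [local instance] LieRing.ofAssociativeRing

variable {n : ℕ} {P : Type*} [AddCommGroup P] [Module ℂ P] [Module (K n) P]
  [IsScalarTower ℂ (K n) P]

instance instModuleKF (V : Type*) [AddCommGroup V] [Module ℂ V] : Module (K n) (F n P V) :=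
  inferInstanceAs (Module (K n) (P ⊗[ℂ] V))

instance instIsScalarTowerF (V : Type*) [AddCommGroup V] [Module ℂ V] :
    IsScalarTower ℂ (K n) (F n P V) :=
  inferInstanceAs (IsScalarTower ℂ (K n) (P ⊗[ℂ] V))

variable (n) in
/-- The pure tensor `p ⊗ v` in `𝓕(P, V)`. -/
def tm {V : Type*} [AddCommGroup V] [Module ℂ V] (p : P) (v : V) : F n P V := p ⊗ₜ[ℂ] v

section

variable {V V' V'' : Type*} [AddCommGroup V] [Module ℂ V] [AddCommGroup V'] [Module ℂ V']
  [AddCommGroup V''] [Module ℂ V'']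

theorem F_induction {motive : F n P V → Prop} (tmul : ∀ p v, motive (tm n p v))
    (add : ∀ y z, motive y → motive z → motive (y + z)) (z : F n P V) : motive z :=
  TensorProduct.induction_on z (by rw [← TensorProduct.zero_tmul P (0 : V)]; exact tmul 0 0)
    tmul add

variable (n P) in
/-- The `𝒦_n`-linear map `1 ⊗ T`. -/
def fT (T : V →ₗ[ℂ] V') : F n P V →ₗ[K n] F n P V' :=
  (TensorProduct.AlgebraTensorModule.lTensor (K n) P T : P ⊗[ℂ] V →ₗ[K n] P ⊗[ℂ] V')

theorem fT_tm (T : V →ₗ[ℂ] V') (p : P) (v : V) : fT n P T (tm n p v) = tm n p (T v) := rfl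

theorem fT_fT (S : V' →ₗ[ℂ] V'') (T : V →ₗ[ℂ] V') (z : F n P V) :
    fT n P S (fT n P T z) = fT n P (S ∘ₗ T) z := by
  induction z using F_induction with
  | tmul p v => rfl
  | add y z hy hz => simp only [map_add, hy, hz]

theorem fT_add (S T : V →ₗ[ℂ] V') (z : F n P V) :
    fT n P (S + T) z = fT n P S z + fT n P T z := by
  induction z using F_induction with
  | tmul p v => exact TensorProduct.tmul_add p (S v) (T v)
  | add y z hy hz => simp only [map_add, hy, hz]; abel

theorem fT_smul (c : ℂ) (T : V →ₗ[ℂ] V') (z : F n P V) :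
    fT n P (c • T) z = c • fT n P T z := by
  induction z using F_induction with
  | tmul p v => exact TensorProduct.tmul_smul c p (T v)
  | add y z hy hz => simp only [map_add, hy, hz, smul_add]

theorem fT_neg (T : V →ₗ[ℂ] V') (z : F n P V) : fT n P (-T) z = -fT n P T z := by
  rw [← neg_one_smul ℂ T, fT_smul, neg_one_smul]

theorem fT_zero (z : F n P V) : fT n P (0 : V →ₗ[ℂ] V') z = 0 := by
  rw [← zero_smul ℂ (0 : V →ₗ[ℂ] V'), fT_smul, zero_smul]

theorem fT_id (z : F n P V) : fT n P (LinearMap.id : V →ₗ[ℂ] V) z = z := by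
  induction z using F_induction with
  | tmul p v => rfl
  | add y z hy hz => simp only [map_add, hy, hz]

end

theorem lie_tm {V : Type*} [AddCommGroup V] [Module ℂ V] [LieRingModule (gl n) V]
    [LieModule ℂ (gl n) V] (u : Fin n → ℂ) (r : Fin n → ℤ) (p : P) (v : V) :
    ⁅D u r, tm n p v⁆ = tm n (WtoK n (D u r) • p) v +
      tm n ((xK r : K n) • p) ⁅Matrix.vecMulVec (fun i => (r i : ℂ)) u, v⁆ :=
  D_lie_tmul u r p v

/-- An integral vector as a complex vector. -/
def cvec (r : Fin n → ℤ) : Fin n → ℂ := fun i => r i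

theorem pair_eq_dotProduct (u : Fin n → ℂ) (r : Fin n → ℤ) : pair u r = u ⬝ᵥ cvec r := rfl

/-- This separates the action into its `𝒦_n`-part and its `𝔤𝔩_n`-part, with the monomial pulled out
in front, so that later computations take place inside the bracket. -/
theorem D_lie_eq {k : ℕ} (u : Fin n → ℂ) (r : Fin n → ℤ) (z : F n P (Vd n k)) :
    ⁅D u r, z⁆ = (xK r : K n) • (dK u • z + fT n P (der k (Matrix.vecMulVec (cvec r) u)) z) := by
  induction z using F_induction with
  | tmul p v =>
    rw [lie_tm, WtoK_D, mul_smul, smul_add, fT_tm]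
    rfl
  | add y z hy hz =>
    simp only [lie_add, hy, hz, map_add, smul_add]
    abel

/-- On the trivial `𝔤𝔩_n`-module a vector field acts through `P`. -/
theorem D_lie_zero (u : Fin n → ℂ) (r : Fin n → ℤ) (z : F n P (Vd n 0)) :
    ⁅D u r, z⁆ = WtoK n (D u r) • z := by
  have : der 0 (Matrix.vecMulVec (cvec r) u) = 0 := LinearMap.ext fun w => der_zero _ w
  rw [D_lie_eq, this, fT_zero, add_zero, WtoK_D, mul_smul]

variable (P) in
/-- The exterior product `1 ⊗ (v ∧ ·)`. -/
def ew (k : ℕ) (v : Fin n → ℂ) : F n P (Vd n k) →ₗ[K n] F n P (Vd n (k + 1)) := fT n P (wedge k v)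

variable (P) in
/-- The contraction `1 ⊗ ι_u`. -/
def io (k : ℕ) (u : Fin n → ℂ) : F n P (Vd n (k + 1)) →ₗ[K n] F n P (Vd n k) := fT n P (ctr k u)

variable {k : ℕ}

theorem ew_add (u v : Fin n → ℂ) (z : F n P (Vd n k)) :
    ew P k (u + v) z = ew P k u z + ew P k v z := by
  rw [ew, wedge_add, fT_add]; rfl

theorem ew_smul (c : ℂ) (v : Fin n → ℂ) (z : F n P (Vd n k)) :
    ew P k (c • v) z = c • ew P k v z := by
  rw [ew, wedge_smul, fT_smul]; rfl

theorem ew_sub (u v : Fin n → ℂ) (z : F n P (Vd n k)) :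
    ew P k (u - v) z = ew P k u z - ew P k v z := by
  rw [sub_eq_add_neg, ← neg_one_smul ℂ v, ew_add, ew_smul, neg_one_smul, sub_eq_add_neg]

theorem io_add (u v : Fin n → ℂ) (z : F n P (Vd n (k + 1))) :
    io P k (u + v) z = io P k u z + io P k v z := by
  rw [io, ctr_add, fT_add]; rfl

theorem io_smul (c : ℂ) (u : Fin n → ℂ) (z : F n P (Vd n (k + 1))) :
    io P k (c • u) z = c • io P k u z := by
  rw [io, ctr_smul, fT_smul]; rfl

theorem io_sub (u v : Fin n → ℂ) (z : F n P (Vd n (k + 1))) :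
    io P k (u - v) z = io P k u z - io P k v z := by
  rw [sub_eq_add_neg, ← neg_one_smul ℂ v, io_add, io_smul, neg_one_smul, sub_eq_add_neg]

theorem ew_anticomm (u v : Fin n → ℂ) (z : F n P (Vd n k)) :
    ew P (k + 1) u (ew P k v z) = -ew P (k + 1) v (ew P k u z) := by
  rw [ew, ew, ew, ew, fT_fT, fT_fT, ← fT_neg]
  congr 2
  exact LinearMap.ext fun w => wedge_anticomm u v w

theorem ew_self (u : Fin n → ℂ) (z : F n P (Vd n k)) : ew P (k + 1) u (ew P k u z) = 0 := by
  have h := ew_anticomm u u z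
  rw [eq_neg_iff_add_eq_zero, ← two_smul ℂ] at h
  exact (smul_eq_zero.mp h).resolve_left two_ne_zero

theorem io_anticomm (u v : Fin n → ℂ) (z : F n P (Vd n (k + 2))) :
    io P k u (io P (k + 1) v z) = -io P k v (io P (k + 1) u z) := by
  rw [io, io, io, io, fT_fT, fT_fT, ← fT_neg]
  congr 2
  exact LinearMap.ext fun w => ctr_anticomm u v w

theorem io_self (u : Fin n → ℂ) (z : F n P (Vd n (k + 2))) :
    io P k u (io P (k + 1) u z) = 0 := by
  have h := io_anticomm u u z
  rw [eq_neg_iff_add_eq_zero, ← two_smul ℂ] at h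
  exact (smul_eq_zero.mp h).resolve_left two_ne_zero

theorem io_ew (u v : Fin n → ℂ) (z : F n P (Vd n (k + 1))) :
    io P (k + 1) u (ew P (k + 1) v z) = (u ⬝ᵥ v) • z - ew P k v (io P k u z) := by
  have h : ctr (k + 1) u ∘ₗ wedge (k + 1) v =
      (u ⬝ᵥ v) • LinearMap.id + -(wedge k v ∘ₗ ctr k u) := by
    apply LinearMap.ext
    intro w
    rw [← sub_eq_add_neg]
    exact ctr_wedge u v w
  rw [io, ew, ew, io, fT_fT, fT_fT, h, fT_add, fT_smul, fT_id, fT_neg, sub_eq_add_neg]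

theorem io_ew_zero (u v : Fin n → ℂ) (z : F n P (Vd n 0)) :
    io P 0 u (ew P 0 v z) = (u ⬝ᵥ v) • z := by
  have h : ctr 0 u ∘ₗ wedge 0 v = (u ⬝ᵥ v) • LinearMap.id :=
    LinearMap.ext fun w => ctr_wedge_zero u v w
  rw [io, ew, fT_fT, h, fT_smul, fT_id]

/-- The matrix in the action formula has rank one, so its action on forms factors as a contraction
followed by an exterior product. All later identities use this form of the action. -/
theorem D_lie_succ (u : Fin n → ℂ) (r : Fin n → ℤ) (z : F n P (Vd n (k + 1))) :
    ⁅D u r, z⁆ = (xK r : K n) • (dK u • z + ew P k (cvec r) (io P k u z)) := by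
  rw [D_lie_eq, der_vecMulVec, ← fT_fT]
  rfl

theorem d_apply (z : F n P (Vd n k)) :
    d n P k z = ∑ i, ew P k (Pi.single i 1) ((pdK i : K n) • z) := by
  induction z using F_induction with
  | tmul p v => exact dOp_tmul p v
  | add y z hy hz => simp only [map_add, hy, hz, smul_add, Finset.sum_add_distrib]

theorem ew_eq_sum (v : Fin n → ℂ) (z : F n P (Vd n k)) :
    ew P k v z = ∑ i, v i • ew P k (Pi.single i 1) z := by
  have h : ∀ s : Finset (Fin n), ew P k (∑ i ∈ s, v i • Pi.single i 1) z =
      ∑ i ∈ s, v i • ew P k (Pi.single i 1) z := by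
    intro s
    classical
    induction s using Finset.induction_on with
    | empty => rw [Finset.sum_empty, Finset.sum_empty, ← zero_smul ℂ (0 : Fin n → ℂ), ew_smul,
        zero_smul]
    | insert a s ha ih => rw [Finset.sum_insert ha, Finset.sum_insert ha, ew_add, ew_smul, ih]
  rw [← h Finset.univ]
  congr 1
  conv_lhs => rw [pi_eq_sum_univ' v]

/-- Conjugating by `x^t` replaces each `∂_i` by `∂_i + t_i`, which twists `d` by exterior
multiplication with `t`. -/
theorem d_xK_smul (t : Fin n → ℤ) (z : F n P (Vd n k)) :
    d n P k ((xK t : K n) • z) = (xK t : K n) • (d n P k z + ew P k (cvec t) z) := by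
  rw [d_apply, d_apply, ew_eq_sum, ← Finset.sum_add_distrib, Finset.smul_sum]
  refine Finset.sum_congr rfl fun j _ => ?_
  rw [← dK_single, dK_smul_xK_smul, pair_single, map_smul, map_add]
  congr 2
  exact LinearMap.map_smul_of_tower _ _ _

theorem d_ew (v : Fin n → ℂ) (z : F n P (Vd n k)) :
    d n P (k + 1) (ew P k v z) = -ew P (k + 1) v (d n P k z) := by
  rw [d_apply, d_apply, map_sum, ← Finset.sum_neg_distrib]
  refine Finset.sum_congr rfl fun j _ => ?_
  rw [← map_smul, ew_anticomm]

theorem sum_dotProduct_smul (u : Fin n → ℂ) (z : F n P (Vd n k)) :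
    ∑ i, (u ⬝ᵥ Pi.single i 1) • (pdK i : K n) • z = dK u • z := by
  rw [dK_smul_eq_sum]
  refine Finset.sum_congr rfl fun i _ => ?_
  rw [dotProduct_single, mul_one]

/-- Cartan's formula `d ι_u + ι_u d = ∂_u` for a constant vector field. -/
theorem d_io (u : Fin n → ℂ) (z : F n P (Vd n (k + 1))) :
    d n P k (io P k u z) = dK u • z - io P (k + 1) u (d n P (k + 1) z) := by
  rw [d_apply, d_apply, map_sum, ← sum_dotProduct_smul, ← Finset.sum_sub_distrib]
  refine Finset.sum_congr rfl fun j _ => ?_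
  rw [io_ew, sub_sub_cancel, map_smul, map_smul, map_smul]

theorem io_d_zero (u : Fin n → ℂ) (z : F n P (Vd n 0)) :
    io P 0 u (d n P 0 z) = dK u • z := by
  rw [d_apply, map_sum, ← sum_dotProduct_smul]
  exact Finset.sum_congr rfl fun j _ => io_ew_zero _ _ _

theorem d_d (z : F n P (Vd n k)) : d n P (k + 1) (d n P k z) = 0 := by
  rw [d_apply z, map_sum]
  have h : ∀ j, d n P (k + 1) (ew P k (Pi.single j 1) ((pdK j : K n) • z)) =
      ∑ i, (pdK i * pdK j : K n) • ew P (k + 1) (Pi.single i 1) (ew P k (Pi.single j 1) z) := by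
    intro j
    rw [d_apply]
    refine Finset.sum_congr rfl fun i _ => ?_
    simp only [map_smul, mul_smul]
  simp only [h]
  -- Exchanging the two indices changes the sign of the wedge and leaves the product of the
  -- commuting `∂_i` alone, so the sum equals its own negative.
  have hS : ∑ j, ∑ i, (pdK i * pdK j : K n) • ew P (k + 1) (Pi.single i 1)
      (ew P k (Pi.single j 1) z) = -∑ j, ∑ i, (pdK i * pdK j : K n) • ew P (k + 1) (Pi.single i 1)
      (ew P k (Pi.single j 1) z) := by
    conv_lhs => rw [Finset.sum_comm]
    rw [← Finset.sum_neg_distrib]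
    refine Finset.sum_congr rfl fun j _ => ?_
    rw [← Finset.sum_neg_distrib]
    refine Finset.sum_congr rfl fun i _ => ?_
    rw [ew_anticomm, smul_neg, pdK_mul_comm]
  rw [eq_neg_iff_add_eq_zero, ← two_smul ℂ] at hS
  exact (smul_eq_zero.mp hS).resolve_left two_ne_zero

/-- Cartan's formula for the action of `D(u, r)`. -/
theorem D_lie_eq_cartan (u : Fin n → ℂ) (r : Fin n → ℤ) (z : F n P (Vd n (k + 1))) :
    ⁅D u r, z⁆ = d n P k ((xK r : K n) • io P k u z) +
      (xK r : K n) • io P (k + 1) u (d n P (k + 1) z) := by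
  rw [D_lie_succ, d_xK_smul, d_io, ← smul_add]
  congr 1
  abel

/-- The number operator on `⋀^{k+1}`. -/
theorem sum_ew_io (z : F n P (Vd n (k + 1))) :
    ∑ i, ew P k (Pi.single i 1) (io P k (Pi.single i 1) z) = ((k : ℂ) + 1) • z := by
  -- The identity matrix acts on the exterior power of degree `k + 1` by the scalar `k + 1`; writing
  -- it as a sum of rank one matrices turns this into the identity sought.
  have h1 : (1 : gl n) = ∑ i, Matrix.vecMulVec (Pi.single i 1) (Pi.single i 1) := by
    ext a b
    rw [Matrix.sum_apply]
    simp [Matrix.one_apply, Matrix.vecMulVec_apply, Pi.single_apply]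
  have h2 : der (k + 1) (1 : gl n) = ((k : ℂ) + 1) • LinearMap.id := by
    apply Vd_ext
    intro v
    rw [der_wedges]
    simp only [Matrix.one_mulVec, Function.update_eq_self, Finset.sum_const, Finset.card_univ,
      Fintype.card_fin, LinearMap.smul_apply, LinearMap.id_apply]
    rw [← Nat.cast_smul_eq_nsmul ℂ]
    push_cast
    rfl
  let g : gl n →+ (Vd n (k + 1) →ₗ[ℂ] Vd n (k + 1)) :=
    AddMonoidHom.mk' (der (k + 1)) fun X Y => LinearMap.ext (der_add X Y)
  have h3 : ((k : ℂ) + 1) • LinearMap.id =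
      ∑ i : Fin n, wedge k (Pi.single i 1) ∘ₗ ctr k (Pi.single i 1) := by
    rw [← h2, h1]
    change g _ = _
    rw [map_sum]
    exact Finset.sum_congr rfl fun i _ => der_vecMulVec _ _ k
  have h4 : ∀ s : Finset (Fin n),
      fT n P (∑ i ∈ s, wedge k (Pi.single i 1) ∘ₗ ctr k (Pi.single i 1)) z =
      ∑ i ∈ s, ew P k (Pi.single i 1) (io P k (Pi.single i 1) z) := by
    intro s
    classical
    induction s using Finset.induction_on with
    | empty => rw [Finset.sum_empty, Finset.sum_empty, fT_zero]
    | insert a s ha ih =>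
      rw [Finset.sum_insert ha, Finset.sum_insert ha, fT_add, ih, ← fT_fT]
      rfl
  rw [← h4, ← h3, fT_smul, fT_id]

/-- Otherwise the number operator would kill `z`, though its eigenvalue `k + 1` is nonzero. -/
theorem exists_io_ne_zero {z : F n P (Vd n (k + 1))} (hz : z ≠ 0) :
    ∃ i, io P k (Pi.single i 1) z ≠ 0 := by
  by_contra! h
  have := sum_ew_io z
  simp only [h, map_zero, Finset.sum_const_zero] at this
  exact hz ((smul_eq_zero.mp this.symm).resolve_left (Nat.cast_add_one_ne_zero k))

end KModule

/-! ### Irreducibility under the Weyl algebra and `𝔤𝔩_n`, and the top degree -/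

section Irreducible

variable {n : ℕ} {P : Type*} [AddCommGroup P] [Module ℂ P] [Module (K n) P]
  [IsScalarTower ℂ (K n) P]

variable (n) in
/-- `V(δ_0)` is the trivial one-dimensional module. -/
def equivVZero : Vd n 0 ≃ₗ[ℂ] ℂ := exteriorPower.zeroEquiv ℂ (Fin n → ℂ)

variable (n P) in
/-- `𝓕(P, V(δ_0)) ≅ P` as `𝒦_n`-modules. -/
def equivFZero : F n P (Vd n 0) ≃ₗ[K n] P :=
  ((TensorProduct.AlgebraTensorModule.congr (LinearEquiv.refl (K n) P)
    (equivVZero n)).trans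
      (TensorProduct.AlgebraTensorModule.rid ℂ (K n) P) :
    P ⊗[ℂ] Vd n 0 ≃ₗ[K n] P)

theorem equivFZero_tm (p : P) (w : Vd n 0) :
    equivFZero n P (tm n p w) = equivVZero n w • p := rfl

variable {k : ℕ}

/-- The complement of the number operator. Its eigenvalue `n - k` vanishes only in top degree, which
is why exterior multiplication detects nonzero forms below that degree. -/
theorem sum_io_ew (z : F n P (Vd n k)) :
    ∑ i, io P k (Pi.single i 1) (ew P k (Pi.single i 1) z) = ((n : ℂ) - k) • z := by
  cases k with
  | zero => simp [io_ew_zero, ← Nat.cast_smul_eq_nsmul ℂ]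
  | succ k =>
    simp only [io_ew, Finset.sum_sub_distrib, sum_ew_io]
    simp [← Nat.cast_smul_eq_nsmul ℂ, sub_smul]

theorem exists_ew_ne_zero (hk : k < n) {z : F n P (Vd n k)} (hz : z ≠ 0) :
    ∃ i, ew P k (Pi.single i 1) z ≠ 0 := by
  by_contra! h
  have := sum_io_ew z
  simp only [h, map_zero, Finset.sum_const_zero] at this
  refine hz ((smul_eq_zero.mp this.symm).resolve_left ?_)
  exact sub_ne_zero.mpr (by exact_mod_cast hk.ne')

/-- `𝓕(P, V(δ_k))` is nonzero for `k ≤ n`. -/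
theorem nontrivial_F [Nontrivial P] : ∀ {k : ℕ}, k ≤ n → Nontrivial (F n P (Vd n k))
  | 0, _ => (equivFZero n P).toEquiv.nontrivial
  | k + 1, hk => by
    have : Nontrivial (F n P (Vd n k)) := nontrivial_F (Nat.le_of_succ_le hk)
    obtain ⟨z, hz⟩ := exists_ne (0 : F n P (Vd n k))
    obtain ⟨i, hi⟩ := exists_ew_ne_zero hk hz
    exact nontrivial_of_ne _ _ hi

/-- A nonzero `𝒦_n`-submodule of `P ⊗ ⋀^k` stable under `𝔤𝔩_n` is everything, if `P` is simple. -/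
theorem eq_top_of_gl_stable [IsSimpleModule (K n) P] : ∀ {k : ℕ}
    {M : Submodule (K n) (F n P (Vd n k))}, M ≠ ⊥ →
    (∀ i j, ∀ z ∈ M, fT n P (der k (Matrix.vecMulVec (Pi.single i 1) (Pi.single j 1))) z ∈ M) →
    M = ⊤
  | 0, M, h0, _ => by
    have := IsSimpleModule.congr (equivFZero n P)
    exact (eq_bot_or_eq_top M).resolve_left h0
  | k + 1, M, h0, hM => by
    have hE : ∀ i j, ∀ z ∈ M, ew P k (Pi.single i 1) (io P k (Pi.single j 1) z) ∈ M := by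
      intro i j z hz
      have := hM i j z hz
      rwa [der_vecMulVec, ← fT_fT] at this
    -- Induction on the degree, through the forms whose wedge with each `e_i` lies in `M`. This
    -- space contains every contraction of `M` by a basis vector, hence is nonzero.
    let M' : Submodule (K n) (F n P (Vd n k)) := ⨅ i, M.comap (ew P k (Pi.single i 1))
    have hmem : ∀ {z}, z ∈ M' ↔ ∀ i, ew P k (Pi.single i 1) z ∈ M := by
      intro z
      simp [M']
    have htop : M' = ⊤ := by
      apply eq_top_of_gl_stable
      · obtain ⟨v, hv, hv0⟩ := Submodule.exists_mem_ne_zero_of_ne_bot h0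
        obtain ⟨j, hj⟩ := exists_io_ne_zero hv0
        intro h
        apply hj
        have : io P k (Pi.single j 1) v ∈ M' := hmem.mpr fun i => hE i j v hv
        rwa [h, Submodule.mem_bot] at this
      · intro i j z hz
        rw [hmem] at hz ⊢
        intro l
        -- The commutator of `E_ij` with `e_l ∧ ·` is `δ_jl e_i ∧ ·`, so `M'` inherits stability
        -- under `𝔤𝔩_n`.
        have h1 : wedge k (Pi.single l 1) ∘ₗ
            der k (Matrix.vecMulVec (Pi.single i 1) (Pi.single j 1)) =
            der (k + 1) (Matrix.vecMulVec (Pi.single i 1) (Pi.single j 1)) ∘ₗ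
              wedge k (Pi.single l 1) +
              (-((Pi.single j 1 : Fin n → ℂ) ⬝ᵥ Pi.single l 1)) • wedge k (Pi.single i 1) := by
          apply LinearMap.ext
          intro w
          simp only [LinearMap.comp_apply, LinearMap.add_apply, LinearMap.smul_apply, der_wedge,
            vecMulVec_mulVec_eq, wedge_smul]
          module
        rw [ew, fT_fT, h1, fT_add, ← fT_fT, fT_smul]
        exact M.add_mem (hM i j _ (hz l)) (M.smul_of_tower_mem _ (hz i))
    refine (Submodule.eq_top_iff' (p := M)).mpr fun z => ?_
    -- Once `M'` is everything, the number operator rebuilds `z` from wedges with its contractions.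
    have h1 : ((k : ℂ) + 1) • z ∈ M := by
      rw [← sum_ew_io]
      refine sum_mem fun i _ => ?_
      have : io P k (Pi.single i 1) z ∈ M' := by rw [htop]; trivial
      exact hmem.mp this i
    have h2 := M.smul_of_tower_mem ((k : ℂ) + 1)⁻¹ h1
    rwa [smul_smul, inv_mul_cancel₀ (Nat.cast_add_one_ne_zero k), one_smul] at h2

theorem F_top_succ_eq_zero (z : F n P (Vd n (n + 1))) : z = 0 := by
  induction z using F_induction with
  | tmul p w =>
    rw [Vd_succ_self_eq_zero w]
    exact TensorProduct.tmul_zero _ _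
  | add y z hy hz => rw [hy, hz, add_zero]

/-- `𝔤𝔩_n` acts on the top exterior power through the trace. -/
theorem fT_der_vecMulVec_top (hn : n ≠ 0) (r u : Fin n → ℂ) (z : F n P (Vd n n)) :
    fT n P (der n (Matrix.vecMulVec r u)) z = (u ⬝ᵥ r) • z := by
  obtain ⟨m, rfl⟩ := Nat.exists_eq_succ_of_ne_zero hn
  have h := io_ew u r z
  rw [F_top_succ_eq_zero (ew P (m + 1) r z), map_zero, eq_comm, sub_eq_zero] at h
  exact ((congr(fT (m + 1) P $(der_vecMulVec r u m) z)).trans (fT_fT _ _ z).symm).trans h.symm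

/-- On the top exterior power `𝔤𝔩_n` acts by scalars, so the `𝔤𝔩_n`-stability needed for
`eq_top_of_gl_stable` holds for every `𝒦_n`-submodule. -/
theorem isSimpleModule_F_top [IsSimpleModule (K n) P] (hn : n ≠ 0) :
    IsSimpleModule (K n) (F n P (Vd n n)) := by
  have := IsSimpleModule.nontrivial (K n) P
  have := nontrivial_F (n := n) (P := P) le_rfl
  rw [isSimpleModule_iff]
  refine IsSimpleOrder.of_forall_eq_top fun M hM => eq_top_of_gl_stable hM ?_
  intro i j z hz
  rw [fT_der_vecMulVec_top hn]
  exact M.smul_of_tower_mem _ hz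

/-- The trace of `r uᵀ` is `(u|r) = 0`, so the matrix part of the action disappears and the analysis
of stable subspaces in degree 0 applies to top forms. -/
theorem D_lie_top (hn : n ≠ 0) {u : Fin n → ℂ} {r : Fin n → ℤ} (h : pair u r = 0)
    (z : F n P (Vd n n)) : ⁅D u r, z⁆ = WtoK n (D u r) • z := by
  rw [D_lie_eq, fT_der_vecMulVec_top hn, ← pair_eq_dotProduct, h, zero_smul, add_zero, WtoK_D,
    mul_smul]

end Irreducible

/-! ### Stable subspaces of closed forms -/

section Closed

variable {n : ℕ} {P : Type*} [AddCommGroup P] [Module ℂ P] [Module (K n) P]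
  [IsScalarTower ℂ (K n) P] {k : ℕ}

theorem ew_neg (v : Fin n → ℂ) (z : F n P (Vd n k)) : ew P k (-v) z = -ew P k v z := by
  rw [← neg_one_smul ℂ v, ew_smul, neg_one_smul]

theorem ew_zero (z : F n P (Vd n k)) : ew P k (0 : Fin n → ℂ) z = 0 := by
  rw [← zero_smul ℂ (0 : Fin n → ℂ), ew_smul, zero_smul]

theorem cvec_add (r s : Fin n → ℤ) : cvec (r + s) = cvec r + cvec s := by
  ext i; simp [cvec]

theorem cvec_sub (r s : Fin n → ℤ) : cvec (r - s) = cvec r - cvec s := by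
  ext i; simp [cvec]

theorem cvec_neg (r : Fin n → ℤ) : cvec (-r) = -cvec r := by
  ext i; simp [cvec]

theorem cvec_zero : cvec (0 : Fin n → ℤ) = 0 := by
  ext i; simp [cvec]

theorem cvec_single (i : Fin n) : cvec (Pi.single i 1 : Fin n → ℤ) = Pi.single i 1 := by
  ext j; simp [cvec, Pi.single_apply]

theorem D_lie_D_lie (a b : Fin n → ℂ) (r s : Fin n → ℤ) (v : F n P (Vd n (k + 2))) :
    ⁅D a r, ⁅D b s, v⁆⁆ = (xK (r + s) : K n) • (dK a • dK b • v +
      dK a • ew P (k + 1) (cvec s) (io P (k + 1) b v) +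
      pair a s • dK b • v + pair a s • ew P (k + 1) (cvec s) (io P (k + 1) b v) +
      dK b • ew P (k + 1) (cvec r) (io P (k + 1) a v) +
      pair a s • ew P (k + 1) (cvec r) (io P (k + 1) b v) -
      ew P (k + 1) (cvec r) (ew P k (cvec s) (io P k a (io P (k + 1) b v)))) := by
  rw [D_lie_succ b s, D_lie_succ a r, dK_smul_xK_smul]
  simp only [map_smul, ← smul_add, xK_smul_xK_smul]
  congr 1
  simp only [map_add, map_smul, smul_add, io_ew, pair_eq_dotProduct, map_sub]
  have h : ∀ (c : ℂ) (z : F n P (Vd n (k + 1))),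
      ew P (k + 1) (cvec r) (c • z) = c • ew P (k + 1) (cvec r) z :=
    fun c z => LinearMap.map_smul_of_tower _ _ _
  rw [h]
  abel

/-- For a closed `v`, Cartan's formula leaves only these three terms; they are the ones that the
second difference in `d_xK_ew_io_io_mem` produces. -/
theorem d_xK_ew_io_io {v : F n P (Vd n (k + 2))} (hv : d n P (k + 2) v = 0) (u u' : Fin n → ℂ)
    (m t : Fin n → ℤ) :
    d n P (k + 1) ((xK t : K n) • ew P k (cvec m) (io P k u (io P (k + 1) u' v))) =
      (xK t : K n) • (dK u' • ew P (k + 1) (cvec m) (io P (k + 1) u v) -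
        dK u • ew P (k + 1) (cvec m) (io P (k + 1) u' v) +
        ew P (k + 1) (cvec t) (ew P k (cvec m) (io P k u (io P (k + 1) u' v)))) := by
  rw [d_xK_smul, d_ew, d_io, d_io, hv, map_zero, sub_zero]
  simp only [map_smul, map_sub]
  congr 1
  abel

section Stable

variable {N : Submodule ℂ (F n P (Vd n (k + 2)))}
  (hN : ∀ (u : Fin n → ℂ) (r : Fin n → ℤ), pair u r = 0 → ∀ v ∈ N, ⁅D u r, v⁆ ∈ N)

include hN

/-- Apply `D(w, t) D(u', 0)` to `v`, shift it to `D(w ∓ u, t ∓ m) D(u', ± m)`, and take the second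
difference. Terms odd in the shift cancel in the sum over both signs; terms with `m ∧ m` or `(u|m)`
vanish, and those carrying `(w|m) m ∧ ι_{u'} v` cancel against each other. What is left is twice an
exact form with the arbitrary monomial `x^t`. The conditions on the pairings make every field
involved divergence free. -/
theorem d_xK_ew_io_io_mem {v : F n P (Vd n (k + 2))} (hv : v ∈ N) (hd : d n P (k + 2) v = 0)
    {u u' w : Fin n → ℂ} {m t : Fin n → ℤ} (hum : pair u m = 0) (hum' : pair u' m = 0)
    (hwt : pair w t = 0) (hwm : pair w m + pair u t = 0) :
    d n P (k + 1) ((xK t : K n) • ew P k (cvec m) (io P k u (io P (k + 1) u' v))) ∈ N := by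
  have h1 := hN (w - u) (t - m) (by
    rw [pair_sub_left, pair_sub_right, pair_sub_right]; linear_combination hwt - hwm + hum) _
    (hN u' m hum' v hv)
  have h2 := hN (w + u) (t + m) (by
    rw [pair_add_left, pair_add, pair_add]; linear_combination hwt + hwm + hum) _
    (hN u' (-m) (by rw [pair_neg_right, hum', neg_zero]) v hv)
  have h3 := hN w t hwt _ (hN u' 0 (pair_zero_right u') v hv)
  have hm : pair w m = -pair u t := by linear_combination hwm
  have key : (2 : ℂ) • d n P (k + 1)
      ((xK t : K n) • ew P k (cvec m) (io P k u (io P (k + 1) u' v))) =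
      ⁅D (w - u) (t - m), ⁅D u' m, v⁆⁆ + ⁅D (w + u) (t + m), ⁅D u' (-m), v⁆⁆ -
        (2 : ℂ) • ⁅D w t, ⁅D u' 0, v⁆⁆ := by
    rw [d_xK_ew_io_io hd, D_lie_D_lie, D_lie_D_lie, D_lie_D_lie]
    simp only [sub_add_cancel, add_neg_cancel_right, add_zero]
    rw [← smul_comm (xK t : K n) (2 : ℂ), ← smul_comm (xK t : K n) (2 : ℂ), ← smul_add, ← smul_sub]
    congr 1
    simp only [cvec_add, cvec_sub, cvec_neg, cvec_zero, ew_add, ew_sub, ew_neg, ew_zero, io_add,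
      io_sub, dK_add, dK_sub, add_smul, sub_smul, pair_add_left, pair_sub_left, pair_neg_right,
      pair_zero_right, hum, hm, map_add, map_sub, map_neg, ew_self, smul_add, smul_sub, smul_neg,
      neg_smul, zero_smul, smul_zero, map_zero, sub_zero, add_zero, two_smul]
    abel
  have := N.smul_mem (2 : ℂ)⁻¹ (N.sub_mem (N.add_mem h1 h2) (N.smul_mem (2 : ℂ) h3))
  rwa [← key, smul_smul, inv_mul_cancel₀ two_ne_zero, one_smul] at this

theorem d_xK_single_mem {v : F n P (Vd n (k + 2))} (hv : v ∈ N) (hd : d n P (k + 2) v = 0)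
    {i j l : Fin n} (hij : i ≠ j) (hil : i ≠ l) (t : Fin n → ℤ) :
    d n P (k + 1) ((xK t : K n) • ew P k (Pi.single i 1)
      (io P k (Pi.single j 1) (io P (k + 1) (Pi.single l 1) v))) ∈ N := by
  rw [← cvec_single]
  -- As in degree 0, `w` is built from two coordinates of `t` so as to be orthogonal to `t`, with
  -- `(w|e_i) = -t_j`. The index `i` must differ from `j` and `l` so that `e_j` and `e_l` are
  -- orthogonal to `e_i`.
  refine d_xK_ew_io_io_mem hN hv hd (w := (t i : ℂ) • Pi.single j 1 - (t j : ℂ) • Pi.single i 1)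
    ?_ ?_ ?_ ?_
  · simp [pair_single, hij.symm]
  · simp [pair_single, hil.symm]
  · simp only [pair_comb, pair_single]; ring
  · simp [pair_comb, pair_single, hij.symm]

end Stable

/-- A nonzero double contraction `y = ι_j ι_l v` has degree `k` and does not involve `e_j` or `e_l`.
If wedging with every other `e_i` killed it, it would have to involve all the remaining `n - 2`
directions, so `k = n - 2`; this fails below the top degree. -/
theorem exists_ew_io_io_ne_zero (hk : k + 3 ≤ n) {v : F n P (Vd n (k + 2))} (hv : v ≠ 0) :
    ∃ i j l : Fin n, i ≠ j ∧ i ≠ l ∧ ew P k (Pi.single i 1)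
      (io P k (Pi.single j 1) (io P (k + 1) (Pi.single l 1) v)) ≠ 0 := by
  obtain ⟨l, hl⟩ := exists_io_ne_zero hv
  obtain ⟨j, hj⟩ := exists_io_ne_zero hl
  have hjl : j ≠ l := by
    rintro rfl
    exact hj (io_self _ _)
  set y := io P k (Pi.single j 1) (io P (k + 1) (Pi.single l 1) v) with hy
  by_contra! h
  have h1 := sum_io_ew y
  -- Contracting `y` again by `e_j` or `e_l` gives zero, so these two summands each equal `y`, and
  -- under the contrary assumption the whole sum is `2y` while it must be `(n - k) y`.
  have h2 : ∀ a, a = j ∨ a = l → io P k (Pi.single a 1) (ew P k (Pi.single a 1) y) = y := by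
    intro a ha
    cases k with
    | zero => simp [io_ew_zero]
    | succ k =>
      have : io P k (Pi.single a 1) y = 0 := by
        rcases ha with rfl | rfl
        · exact io_self _ _
        · rw [hy, io_anticomm (Pi.single j 1), map_neg, io_self, neg_zero]
      rw [io_ew, this, map_zero]
      simp
  rw [Finset.sum_eq_add j l hjl, h2 j (Or.inl rfl), h2 l (Or.inr rfl), ← two_smul ℂ, ← sub_eq_zero,
    ← sub_smul] at h1
  · rcases smul_eq_zero.mp h1 with h3 | h3
    · have h4 : ((k + 2 : ℕ) : ℂ) = n := by push_cast; linear_combination h3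
      have h5 : k + 2 = n := by exact_mod_cast h4
      omega
    · exact hj h3
  · rintro a - ⟨haj, hal⟩
    rw [h a j l haj hal, map_zero]
  · simp
  · simp

end Closed

/-! ### From a stable space of closed forms to all exact forms -/

section Main

attribute [local instance] LieRing.ofAssociativeRing

variable {n : ℕ} {P : Type*} [AddCommGroup P] [Module ℂ P] [Module (K n) P]
  [IsScalarTower ℂ (K n) P] {k : ℕ}

/-- If `d` vanished identically, comparing its values on `z` and on `x_i z` would give `e_i ∧ z = 0`
for all `i`, impossible for a nonzero form below top degree. -/
theorem exists_d_ne_zero [Nontrivial P] (hk : k < n) : ∃ z, d n P k z ≠ 0 := by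
  by_contra! h
  have := nontrivial_F (n := n) (P := P) hk.le
  obtain ⟨z, hz⟩ := exists_ne (0 : F n P (Vd n k))
  obtain ⟨i, hi⟩ := exists_ew_ne_zero hk hz
  apply hi
  have h1 := d_xK_smul (Pi.single i 1) z
  rw [h, h, zero_add, cvec_single] at h1
  by_contra h2
  exact xK_smul_ne_zero _ h2 h1.symm

/-- A nonzero space of closed forms of degree between `2` and `n - 1` stable under divergence zero
vector fields contains all exact forms. -/
theorem d_mem_of_stable [IsSimpleModule (K n) P] (hk : k + 3 ≤ n)
    {N : Submodule ℂ (F n P (Vd n (k + 2)))}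
    (hN : ∀ (u : Fin n → ℂ) (r : Fin n → ℤ), pair u r = 0 → ∀ v ∈ N, ⁅D u r, v⁆ ∈ N)
    (hd : ∀ v ∈ N, d n P (k + 2) v = 0) (h0 : N ≠ ⊥) (z : F n P (Vd n (k + 1))) :
    d n P (k + 1) z ∈ N := by
  -- The largest `𝒦_n`-submodule on which `d` takes values in `N`; the goal becomes `M = ⊤`.
  let M : Submodule (K n) (F n P (Vd n (k + 1))) :=
    { carrier := {z | ∀ y : K n, d n P (k + 1) (y • z) ∈ N}
      add_mem' := fun ha hb y => by rw [smul_add, map_add]; exact N.add_mem (ha y) (hb y)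
      zero_mem' := fun y => by rw [smul_zero, map_zero]; exact N.zero_mem
      smul_mem' := fun y z hz y' => by rw [← mul_smul]; exact hz _ }
  have hpd : ∀ i, ∀ v ∈ N, (pdK i : K n) • v ∈ N := by
    intro i v hv
    have := hN (Pi.single i 1) 0 (pair_zero_right _) v hv
    rwa [D_lie_succ, cvec_zero, ew_zero, add_zero, xK_zero, one_smul, dK_single] at this
  have hM : ∀ {u : Fin n → ℂ} {r : Fin n → ℤ}, pair u r = 0 → ∀ z ∈ M,
      ew P k (cvec r) (io P k u z) ∈ M := by
    intro u r hur z hz y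
    have h1 : y • ew P k (cvec r) (io P k u z) =
        (xK r : K n) • ew P k (cvec r) (io P k u ((xK (-r) : K n) • y • z)) := by
      rw [map_smul, map_smul, map_smul, map_smul, xK_smul_xK_smul, add_neg_cancel, xK_zero,
        one_smul]
    have hz' : (xK (-r) : K n) • y • z ∈ M := M.smul_mem _ (M.smul_mem _ hz)
    -- For `Z = x^{-r} y z` in `M`, both `D(u, r) dZ = d(D(u, r) Z)` and `d(x^r ∂_u Z)` lie in `N`.
    -- Their difference is `d(x^r r ∧ ι_u Z)`, and the factor `x^{-r}` cancels the monomial.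
    have h2 := N.sub_mem (hN u r hur _ (hz' 1)) (hz' (xK r * dK u))
    rwa [one_smul, ← LieModuleHom.map_lie, ← map_sub, D_lie_succ, mul_smul, ← smul_sub,
      add_sub_cancel_left, ← h1] at h2
  have hE : ∀ i j, i ≠ j → ∀ z ∈ M, ew P k (Pi.single i 1) (io P k (Pi.single j 1) z) ∈ M := by
    intro i j hij z hz
    have := hM (u := Pi.single j 1) (r := Pi.single i 1) (by simp [pair_single, hij.symm]) z hz
    rwa [cvec_single] at this
  have hH : ∀ i j, ∀ z ∈ M, ew P k (Pi.single i 1) (io P k (Pi.single i 1) z) -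
      ew P k (Pi.single j 1) (io P k (Pi.single j 1) z) ∈ M := by
    intro i j z hz
    by_cases hij : i = j
    · rw [hij, sub_self]; exact M.zero_mem
    -- The orthogonal vectors `e_i - e_j` and `e_i + e_j` give the diagonal part of `𝔰𝔩_n`, up to
    -- off-diagonal units already handled.
    have h1 := hM (u := Pi.single i 1 - Pi.single j 1) (r := Pi.single i 1 + Pi.single j 1)
      (by simp [pair_sub_left, pair_single, hij, Ne.symm hij]) z hz
    rw [cvec_add, cvec_single, cvec_single, ew_add, io_sub, map_sub, map_sub] at h1
    have h2 := M.sub_mem (M.add_mem h1 (hE i j hij z hz)) (hE j i (Ne.symm hij) z hz)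
    convert h2 using 1
    abel
  have hgl : ∀ i j, ∀ z ∈ M, ew P k (Pi.single i 1) (io P k (Pi.single j 1) z) ∈ M := by
    intro i j z hz
    by_cases hij : i = j
    · subst hij
      -- From `𝔰𝔩_n` to `𝔤𝔩_n`: the identity acts on forms of degree `k + 1` by the scalar `k + 1`,
      -- so adding `(k + 1) z` to the sum of the differences `E_ii - E_jj` leaves `n E_ii z`.
      have h1 : ∑ j, (ew P k (Pi.single i 1) (io P k (Pi.single i 1) z) -
          ew P k (Pi.single j 1) (io P k (Pi.single j 1) z)) + ((k : ℂ) + 1) • z ∈ M :=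
        M.add_mem (sum_mem fun j _ => hH i j z hz) (M.smul_of_tower_mem _ hz)
      rw [Finset.sum_sub_distrib, sum_ew_io, sub_add_cancel, Finset.sum_const, Finset.card_univ,
        Fintype.card_fin, ← Nat.cast_smul_eq_nsmul ℂ] at h1
      have h2 := M.smul_of_tower_mem (n : ℂ)⁻¹ h1
      rwa [smul_smul, inv_mul_cancel₀ (Nat.cast_ne_zero.mpr (by omega)), one_smul] at h2
    · exact hE i j hij z hz
  have htop : M = ⊤ := by
    refine eq_top_of_gl_stable ?_ ?_
    · obtain ⟨v, hv, hv0⟩ := Submodule.exists_mem_ne_zero_of_ne_bot h0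
      obtain ⟨i, j, l, hij, hil, hne⟩ := exists_ew_io_io_ne_zero hk hv0
      have h1 : ew P k (Pi.single i 1)
          (io P k (Pi.single j 1) (io P (k + 1) (Pi.single l 1) v)) ∈ M := by
        intro y
        exact smul_mem_of_xK_smul_mem
          (g := fun v => ew P k (Pi.single i 1)
            (io P k (Pi.single j 1) (io P (k + 1) (Pi.single l 1) v)))
          (B := N.comap (d n P (k + 1)).toLinearMap) hpd
          (fun a w => by simp only [map_smul])
          (fun t w hw => d_xK_single_mem hN hw (hd w hw) hij hil t) y hv
      intro h
      rw [h, Submodule.mem_bot] at h1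
      exact hne h1
    · intro i j z hz
      rw [der_vecMulVec, ← fT_fT]
      exact hgl i j z hz
  have hz : z ∈ M := by rw [htop]; trivial
  have := hz 1
  rwa [one_smul] at this

/-! ### Simple submodules -/

theorem isIrreducible_of_le {L₀ M : Type*} [LieRing L₀] [LieAlgebra ℂ L₀] [AddCommGroup M]
    [Module ℂ M] [LieRingModule L₀ M] [LieModule ℂ L₀ M] {N : LieSubmodule ℂ L₀ M} (h0 : N ≠ ⊥)
    (h : ∀ N' : LieSubmodule ℂ L₀ M, N' ≤ N → N' ≠ ⊥ → N ≤ N') :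
    LieModule.IsIrreducible ℂ L₀ N := by
  have : Nontrivial N := (LieSubmodule.nontrivial_iff_ne_bot ℂ L₀ M).mpr h0
  refine LieModule.IsIrreducible.mk fun N' hN' => ?_
  have h1 : N ≤ N'.map N.incl := by
    refine h _ ?_ ?_
    · rintro _ ⟨x, -, rfl⟩
      exact x.2
    · rw [Ne, LieSubmodule.eq_bot_iff]
      rw [Ne, LieSubmodule.eq_bot_iff] at hN'
      contrapose! hN'
      intro x hx
      exact Subtype.ext (hN' _ ⟨x, hx, rfl⟩)
  refine eq_top_iff.mpr fun x _ => ?_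
  obtain ⟨y, hy, hyx⟩ := h1 x.2
  have : y = x := Subtype.ext hyx
  exact this ▸ hy

theorem D_lie_mem {M : Type*} [AddCommGroup M] [Module ℂ M] [LieRingModule (W n) M]
    [LieModule ℂ (W n) M] (N : LieSubmodule ℂ (S n) M) (u : Fin n → ℂ) (r : Fin n → ℤ)
    (h : pair u r = 0) (v : M) (hv : v ∈ N) : ⁅D u r, v⁆ ∈ N :=
  N.lie_mem (x := ⟨D u r, D_mem_S h⟩) hv

theorem mem_L_succ {z : F n P (Vd n (k + 1))} : z ∈ L n P (k + 1) ↔ ∃ y, d n P k y = z :=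
  LieModuleHom.mem_range (d n P k) z

theorem L_succ_ne_bot [Nontrivial P] (hk : k < n) : L n P (k + 1) ≠ ⊥ := by
  obtain ⟨z, hz⟩ := exists_d_ne_zero (n := n) (P := P) hk
  intro h
  rw [LieSubmodule.eq_bot_iff] at h
  exact hz (h _ (mem_L_succ.mpr ⟨z, rfl⟩))

theorem d_eq_zero_of_mem_L {z : F n P (Vd n k)} (hz : z ∈ L n P k) : d n P k z = 0 := by
  cases k with
  | zero =>
    have : z = 0 := hz
    rw [this, map_zero]
  | succ k =>
    obtain ⟨y, rfl⟩ := mem_L_succ.mp hz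
    exact d_d y

theorem d_mem_hP (z : F n P (Vd n k)) : d n P k z ∈ hP n (F n P (Vd n (k + 1))) := by
  rw [d_apply]
  refine sum_mem fun i _ => ?_
  rw [map_smul]
  exact pdK_smul_mem_hP _ _

/-- Every nonzero submodule of `𝓛_n(P, k)` is `𝓛_n(P, k)`, for `2 ≤ k ≤ n`. -/
theorem L_le_of_ne_bot [IsSimpleModule (K n) P] (hk : k + 2 ≤ n)
    {N : LieSubmodule ℂ (S n) (F n P (Vd n (k + 2)))} (hle : N ≤ L n P (k + 2)) (h0 : N ≠ ⊥) :
    L n P (k + 2) ≤ N := by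
  have h0' : N.toSubmodule ≠ ⊥ := by rwa [Ne, LieSubmodule.toSubmodule_eq_bot]
  intro z hz
  obtain ⟨y, rfl⟩ := mem_L_succ.mp hz
  obtain hk | hk := hk.lt_or_eq
  · exact d_mem_of_stable hk (D_lie_mem N) (fun v hv => d_eq_zero_of_mem_L (hle hv)) h0' y
  -- In top degree the double contraction argument fails; there any nonzero stable subspace of `𝔥F`
  -- equals `𝔥F`, and exact forms lie in `𝔥F`.
  · subst hk
    have := isSimpleModule_F_top (n := k + 2) (P := P) (by omega)
    have h1 : N.toSubmodule = hP (k + 2) (F (k + 2) P (Vd (k + 2) (k + 2))) := by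
      refine eq_hP_of_le_hP (by omega) ?_ ?_ h0'
      · intro u r hur v hv
        rw [← D_lie_top (by omega) hur]
        exact D_lie_mem N u r hur v hv
      · intro v hv
        obtain ⟨w, rfl⟩ := mem_L_succ.mp (hle hv)
        exact d_mem_hP w
    have h2 := d_mem_hP (n := k + 2) y
    rw [← h1] at h2
    exact h2

/-- `𝓛_n(P, k)` is simple for `2 ≤ k ≤ n`. -/
theorem isIrreducible_L [IsSimpleModule (K n) P] (hk : k + 2 ≤ n) :
    LieModule.IsIrreducible ℂ (S n) (L n P (k + 2)) := by
  have := IsSimpleModule.nontrivial (K n) P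
  exact isIrreducible_of_le (L_succ_ne_bot hk) fun N hle h0 => L_le_of_ne_bot hk hle h0

/-! ### The maximal submodule -/

/-- The vector fields `D(u, r)` span `W_n`. -/
theorem W_induction {p : W n → Prop} (hD : ∀ u r, p (D u r)) (hadd : ∀ X Y, p X → p Y → p (X + Y))
    (hsmul : ∀ (c : ℂ) X, p X → p (c • X)) (X : W n) : p X := by
  have h0 : p 0 := by
    have := hsmul 0 _ (hD 0 0)
    rwa [zero_smul] at this
  have h1 : ∀ (a : A n) (j : Fin n), p (a • pd j) := by
    intro a j
    have ha : a ∈ Submodule.span ℂ (Set.range (monBasis n)) := by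
      rw [(monBasis n).span_eq]; trivial
    induction ha using Submodule.span_induction with
    | mem b hb =>
      obtain ⟨r, rfl⟩ := hb
      have h2 : mon r • pd j = D (Pi.single j 1) r := by
        rw [D]
        simp [Pi.single_apply]
      rw [monBasis_apply, h2]
      exact hD _ _
    | zero => rwa [zero_smul]
    | add a b _ _ ha hb => rw [add_smul]; exact hadd _ _ ha hb
    | smul c a _ ha => rw [smul_assoc]; exact hsmul _ _ ha
  rw [W_eq_sum X]
  exact Finset.sum_induction _ p hadd h0 fun j _ => h1 _ j

theorem mem_Ltilde {z : F n P (Vd n k)} : z ∈ Ltilde n P k ↔ ∀ X : W n, ⁅X, z⁆ ∈ L n P k := Iff.rfl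

/-- Closed forms lie in `𝓛̃_n(P, k)`, by Cartan's formula. -/
theorem mem_Ltilde_of_d_eq_zero {z : F n P (Vd n (k + 1))} (hz : d n P (k + 1) z = 0) :
    z ∈ Ltilde n P (k + 1) := by
  rw [mem_Ltilde]
  intro X
  induction X using W_induction with
  | hD u r =>
    rw [D_lie_eq_cartan, hz, map_zero, smul_zero, add_zero]
    exact mem_L_succ.mpr ⟨_, rfl⟩
  | hadd X Y hX hY => rw [add_lie]; exact (L n P (k + 1)).add_mem hX hY
  | hsmul c X hX => rw [smul_lie]; exact (L n P (k + 1)).smul_mem c hX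

/-- `𝓕(P, V(δ_k))` has no nonzero `W_n`-invariants for `k ≥ 1`. -/
theorem eq_zero_of_lie_eq_zero {z : F n P (Vd n (k + 1))} (h : ∀ X : W n, ⁅X, z⁆ = 0) : z = 0 := by
  have h1 : ∀ u : Fin n → ℂ, dK u • z = 0 := by
    intro u
    have := h (D u 0)
    rwa [D_lie_succ, cvec_zero, ew_zero, add_zero, xK_zero, one_smul] at this
  by_contra hz
  have h2 := sum_ew_io z
  -- An invariant is killed by each `∂_u`, so the field `D(e_i, e_i)`, which is not divergence free,
  -- shows that `e_i ∧ ι_i z = 0`. Hence the number operator kills `z`.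
  rw [Finset.sum_eq_zero] at h2
  · exact hz ((smul_eq_zero.mp h2.symm).resolve_left (Nat.cast_add_one_ne_zero k))
  · intro i _
    have h3 := h (D (Pi.single i 1) (Pi.single i 1))
    rw [D_lie_succ, h1, zero_add, cvec_single] at h3
    by_contra h4
    exact xK_smul_ne_zero _ h4 h3

/-- `𝓛̃_n(P, k)` is a maximal submodule of `𝓕(P, V(δ_k))` for `1 ≤ k ≤ n - 1`. -/
theorem isCoatom_Ltilde [IsSimpleModule (K n) P] (hk : k + 2 ≤ n) :
    IsCoatom (Ltilde n P (k + 1)) := by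
  have := IsSimpleModule.nontrivial (K n) P
  constructor
  · intro h
    obtain ⟨z, hz⟩ := exists_d_ne_zero (n := n) (P := P) (k := k + 1) hk
    apply hz
    -- If `𝓛̃_n` were everything, each `X z` would be exact and hence closed, making `dz` a
    -- `W_n`-invariant.
    apply eq_zero_of_lie_eq_zero
    intro X
    have h1 : z ∈ Ltilde n P (k + 1) := by rw [h]; trivial
    rw [← LieModuleHom.map_lie]
    exact d_eq_zero_of_mem_L (h1 X)
  · intro N hN
    obtain ⟨v, hv, hv'⟩ := SetLike.exists_of_lt hN
    -- The image of `N` under `d`. It is nonzero because `v`, lying outside `𝓛̃_n`, is not closed;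
    -- so it contains every exact form of the next degree.
    let N₁ : LieSubmodule ℂ (S n) (F n P (Vd n (k + 2))) :=
      { toSubmodule := N.toSubmodule.map (d n P (k + 1)).toLinearMap
        lie_mem := by
          rintro X _ ⟨w, hw, rfl⟩
          exact ⟨⁅X, w⁆, N.lie_mem hw, (d n P (k + 1)).map_lie (X : W n) w⟩ }
    have h1 : L n P (k + 2) ≤ N₁ := by
      refine L_le_of_ne_bot hk ?_ ?_
      · rintro _ ⟨w, -, rfl⟩
        exact mem_L_succ.mpr ⟨w, rfl⟩
      · intro h
        rw [LieSubmodule.eq_bot_iff] at h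
        exact hv' (mem_Ltilde_of_d_eq_zero (h _ ⟨v, hv, rfl⟩))
    refine eq_top_iff.mpr fun y _ => ?_
    obtain ⟨w, hw, hwy⟩ := h1 (mem_L_succ.mpr ⟨y, rfl⟩)
    have h2 : y - w ∈ Ltilde n P (k + 1) := by
      apply mem_Ltilde_of_d_eq_zero
      rw [map_sub, sub_eq_zero]
      exact hwy.symm
    have := N.add_mem (hN.le h2) hw
    rwa [sub_add_cancel] at this

/-- `𝓕(P, V(δ_k))` is reducible for `1 ≤ k ≤ n - 1`. -/
theorem not_isIrreducible_F [IsSimpleModule (K n) P] (hk : k + 1 < n) :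
    ¬ LieModule.IsIrreducible ℂ (S n) (F n P (Vd n (k + 1))) := by
  have := IsSimpleModule.nontrivial (K n) P
  intro h
  obtain h1 | h1 := h.eq_bot_or_eq_top (L n P (k + 1))
  · exact L_succ_ne_bot (by omega) h1
  · obtain ⟨z, hz⟩ := exists_d_ne_zero (n := n) (P := P) hk
    have : z ∈ L n P (k + 1) := by rw [h1]; trivial
    exact hz (d_eq_zero_of_mem_L this)

end Main

theorem le_of_isIrreducible {L₀ M : Type*} [LieRing L₀] [LieAlgebra ℂ L₀] [AddCommGroup M]
    [Module ℂ M] [LieRingModule L₀ M] [LieModule ℂ L₀ M] {N N' : LieSubmodule ℂ L₀ M}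
    (h : LieModule.IsIrreducible ℂ L₀ N) (hle : N' ≤ N) (h0 : N' ≠ ⊥) : N ≤ N' := by
  obtain h1 | h1 := h.eq_bot_or_eq_top (N'.comap N.incl)
  · refine absurd ?_ h0
    rw [LieSubmodule.eq_bot_iff]
    intro x hx
    have : (⟨x, hle hx⟩ : N) ∈ N'.comap N.incl := hx
    rw [h1, LieSubmodule.mem_bot] at this
    exact congrArg Subtype.val this
  · intro x hx
    have : (⟨x, hx⟩ : N) ∈ N'.comap N.incl := by rw [h1]; trivial
    exact this

/-! ### Equivariant maps out of a simple module over the Weyl algebra -/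

section Pushforward

variable {n : ℕ} {P : Type*} [AddCommGroup P] [Module ℂ P] [Module (K n) P]
  [IsScalarTower ℂ (K n) P]

theorem WtoK_smul_mem_hP (X : S n) (p : P) : WtoK n X • p ∈ hP n P := by
  obtain ⟨X, hX⟩ := X
  change X ∈ Submodule.span ℂ (divZeroSet n) at hX
  change WtoK n X • p ∈ hP n P
  induction hX using Submodule.span_induction with
  | mem X hX =>
    obtain ⟨u, r, hu, rfl⟩ := hX
    exact D_smul_mem_hP hu p
  | zero => rw [map_zero, zero_smul]; exact zero_mem _
  | add X Y _ _ hX hY => rw [map_add, add_smul]; exact add_mem hX hY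
  | smul c X _ hX => rw [map_smul, smul_assoc]; exact Submodule.smul_mem _ _ hX

/-- If every `∂_i` were zero on `P`, the commutator `[∂_i, x_i] = x_i` would act by zero, yet `x_i`
is invertible. -/
theorem hP_ne_bot [Nontrivial P] (hn : n ≠ 0) : hP n P ≠ ⊥ := by
  intro h
  obtain ⟨v, hv⟩ := exists_ne (0 : P)
  have hd : ∀ (u : Fin n → ℂ) (q : P), dK u • q = 0 := by
    intro u q
    have := dK_smul_mem_hP u q
    rwa [h, Submodule.mem_bot] at this
  let i : Fin n := ⟨0, Nat.pos_of_ne_zero hn⟩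
  have h1 := dK_smul_xK_smul (Pi.single i 1) (Pi.single i 1) v
  rw [hd, hd, zero_add, pair_single, Pi.single_eq_same, Int.cast_one, one_smul] at h1
  exact xK_smul_ne_zero _ hv h1.symm

variable {M : Type*} [AddCommGroup M] [Module ℂ M] [LieRingModule (S n) M] [LieModule ℂ (S n) M]
  {f : P →ₗ[ℂ] M} (hf : ∀ (X : S n) (p : P), ⁅X, f p⁆ = f (WtoK n X • p))

include hf

theorem D_smul_mem_comap (N : LieSubmodule ℂ (S n) M) (u : Fin n → ℂ) (r : Fin n → ℤ)
    (h : pair u r = 0) (v : P) (hv : v ∈ N.toSubmodule.comap f) :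
    WtoK n (D u r) • v ∈ N.toSubmodule.comap f := by
  have h1 := hf ⟨D u r, D_mem_S h⟩ v
  rw [Submodule.mem_comap]
  change f (WtoK n (D u r) • v) ∈ N
  change _ = f (WtoK n (D u r) • v) at h1
  rw [← h1]
  exact N.lie_mem hv

/-- The image of `𝔥P` under an equivariant map, as an `𝕊_n`-submodule. -/
def mapHP : LieSubmodule ℂ (S n) M where
  toSubmodule := (hP n P).map f
  lie_mem := by
    rintro X _ ⟨p, -, rfl⟩
    exact ⟨_, WtoK_smul_mem_hP X p, (hf X p).symm⟩

theorem hMul_eq_map (hsurj : Function.Surjective f) : hMul n M = (hP n P).map f := by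
  apply le_antisymm
  · rw [hMul, Submodule.span_le]
    rintro _ ⟨X, -, m, rfl⟩
    obtain ⟨p, rfl⟩ := hsurj m
    exact ⟨_, WtoK_smul_mem_hP X p, (hf X p).symm⟩
  · rw [Submodule.map_le_iff_le_comap, hP_le_iff]
    intro i q
    have h1 := hf ⟨pd i, pd_mem_S i⟩ q
    refine Submodule.subset_span ⟨⟨pd i, pd_mem_S i⟩, Submodule.subset_span ⟨i, rfl⟩, f q, ?_⟩
    exact h1.symm

/-- Pulls submodules of `M` back to `P`, where the dichotomy for stable subspaces applies. The
kernel condition, weaker than injectivity, also allows `f` to be the map onto `𝓛_n(P, 1)` when `P ≅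
A_n`. -/
theorem hP_le_comap [IsSimpleModule (K n) P] (hn : 2 ≤ n) (hsurj : Function.Surjective f)
    (hker : ∀ v, f v ≠ 0 → ∃ i, (pdK i : K n) • v ≠ 0) {N : LieSubmodule ℂ (S n) M} (hN : N ≠ ⊥) :
    hP n P ≤ N.toSubmodule.comap f := by
  obtain ⟨m, hm, hm0⟩ := Submodule.exists_mem_ne_zero_of_ne_bot
    (p := N.toSubmodule) (by rwa [Ne, LieSubmodule.toSubmodule_eq_bot])
  obtain ⟨v, rfl⟩ := hsurj m
  obtain ⟨i, hi⟩ := hker v hm0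
  exact hP_le_of_stable (D_smul_mem_comap hf N) hn hm hi

theorem isIrreducible_of_map_hP_eq_top [IsSimpleModule (K n) P] (hn : 2 ≤ n)
    (hsurj : Function.Surjective f) (hker : ∀ v, f v ≠ 0 → ∃ i, (pdK i : K n) • v ≠ 0)
    [Nontrivial M] (htop : (hP n P).map f = ⊤) : LieModule.IsIrreducible ℂ (S n) M := by
  refine LieModule.IsIrreducible.mk fun N hN => ?_
  have h1 := Submodule.map_le_iff_le_comap.mpr (hP_le_comap hf hn hsurj hker hN)
  rw [htop] at h1
  exact eq_top_iff.mpr h1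

theorem hP_eq_top_of_isIrreducible [Nontrivial P] (hn : n ≠ 0) (hinj : Function.Injective f)
    (h : LieModule.IsIrreducible ℂ (S n) M) : hP n P = ⊤ := by
  obtain h1 | h1 := h.eq_bot_or_eq_top (mapHP hf)
  · have h2 : (hP n P).map f = ⊥ := congrArg LieSubmodule.toSubmodule h1
    rw [← Submodule.map_bot f] at h2
    exact absurd (Submodule.map_injective_of_injective hinj h2) (hP_ne_bot hn)
  · have h2 : (hP n P).map f = ⊤ := congrArg LieSubmodule.toSubmodule h1
    refine (Submodule.eq_top_iff' (p := hP n P)).mpr fun p => ?_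
    have h3 : f p ∈ (hP n P).map f := by rw [h2]; trivial
    obtain ⟨q, hq, hqp⟩ := h3
    exact hinj hqp ▸ hq

/-- Every nonzero submodule contains the image of `𝔥P`, which gives simplicity and uniqueness at
once. -/
theorem isUniqueSimpleSubmodule_hMul [IsSimpleModule (K n) P] (hn : 2 ≤ n)
    (hbij : Function.Bijective f) (hker : ∀ v : P, v ≠ 0 → ∃ i, (pdK i : K n) • v ≠ 0) :
    IsUniqueSimpleSubmodule (S n) (hMul n M) := by
  have := IsSimpleModule.nontrivial (K n) P
  have hker' : ∀ v, f v ≠ 0 → ∃ i, (pdK i : K n) • v ≠ 0 := by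
    intro v hv
    refine hker v ?_
    rintro rfl
    exact hv (map_zero f)
  have hle : ∀ N : LieSubmodule ℂ (S n) M, N ≠ ⊥ → mapHP hf ≤ N := fun N hN =>
    Submodule.map_le_iff_le_comap.mpr (hP_le_comap hf hn hbij.2 hker' hN)
  have h0 : mapHP hf ≠ ⊥ := by
    intro h
    have h2 : (hP n P).map f = ⊥ := congrArg LieSubmodule.toSubmodule h
    rw [← Submodule.map_bot f] at h2
    exact hP_ne_bot (by omega) (Submodule.map_injective_of_injective hbij.1 h2)
  refine ⟨mapHP hf, (hMul_eq_map hf hbij.2).symm, isIrreducible_of_le h0 fun N _ hN => hle N hN, ?_⟩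
  intro N hN
  have hN0 : N ≠ ⊥ := (LieSubmodule.nontrivial_iff_ne_bot ℂ (S n) M).mp
    (LieModule.nontrivial_of_isIrreducible ℂ (S n) N)
  exact le_antisymm (le_of_isIrreducible hN (hle N hN0) h0) (hle N hN0)

end Pushforward

/-! ### Degrees zero and one -/

section Degree

variable {n : ℕ} {P : Type*} [AddCommGroup P] [Module ℂ P] [Module (K n) P]
  [IsScalarTower ℂ (K n) P]

theorem W_lie_zero (X : W n) (z : F n P (Vd n 0)) : ⁅X, z⁆ = WtoK n X • z := by
  induction X using W_induction with
  | hD u r => exact D_lie_zero u r z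
  | hadd X Y hX hY => rw [add_lie, hX, hY, map_add, add_smul]
  | hsmul c X hX => rw [smul_lie, hX, map_smul, smul_assoc]

variable (n P) in
/-- The `ℂ`-linear isomorphism `P ≅ 𝓕(P, V(δ_0))`. -/
def toFZero : P ≃ₗ[ℂ] F n P (Vd n 0) := (equivFZero n P).symm.restrictScalars ℂ

theorem toFZero_smul (y : K n) (p : P) : toFZero n P (y • p) = y • toFZero n P p :=
  (equivFZero n P).symm.map_smul y p

theorem lie_toFZero (X : S n) (p : P) :
    ⁅X, (toFZero n P : P →ₗ[ℂ] F n P (Vd n 0)) p⁆ =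
      (toFZero n P : P →ₗ[ℂ] F n P (Vd n 0)) (WtoK n X • p) := by
  refine Eq.trans ?_ (toFZero_smul (WtoK n (X : W n)) p).symm
  exact W_lie_zero (X : W n) _

variable (n P) in
/-- The composite `P ≅ 𝓕(P, V(δ_0)) → 𝓛_n(P, 1)`. -/
def toLOne : P →ₗ[ℂ] L n P 1 :=
  LinearMap.codRestrict (L n P 1).toSubmodule
    ((d n P 0).toLinearMap ∘ₗ (toFZero n P : P →ₗ[ℂ] F n P (Vd n 0)))
    fun p => mem_L_succ.mpr ⟨toFZero n P p, rfl⟩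

theorem toLOne_coe (p : P) : (toLOne n P p : F n P (Vd n 1)) = d n P 0 (toFZero n P p) := rfl

theorem lie_toLOne (X : S n) (p : P) : ⁅X, toLOne n P p⁆ = toLOne n P (WtoK n X • p) := by
  apply Subtype.ext
  rw [toLOne_coe, toFZero_smul]
  change ⁅(X : W n), d n P 0 (toFZero n P p)⁆ = _
  rw [← LieModuleHom.map_lie, W_lie_zero]

theorem toLOne_surjective : Function.Surjective (toLOne n P) := by
  rintro ⟨z, hz⟩
  obtain ⟨y, rfl⟩ := mem_L_succ.mp hz
  refine ⟨(toFZero n P).symm y, Subtype.ext ?_⟩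
  rw [toLOne_coe, LinearEquiv.apply_symm_apply]

/-- Contracting `dz` with `e_i` recovers `∂_i z`. Thus the kernel is the space of vectors killed by
`𝔥`, which is zero unless `P ≅ A_n`. -/
theorem toLOne_eq_zero_iff {p : P} : toLOne n P p = 0 ↔ ∀ i, (pdK i : K n) • p = 0 := by
  constructor
  · intro h i
    have h1 : d n P 0 (toFZero n P p) = 0 := congrArg Subtype.val h
    have h2 := io_d_zero (Pi.single i 1) (toFZero n P p)
    rw [h1, map_zero, dK_single, ← toFZero_smul] at h2
    exact (LinearEquiv.map_eq_zero_iff _).mp h2.symm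
  · intro h
    apply Subtype.ext
    rw [toLOne_coe, d_apply]
    refine Finset.sum_eq_zero fun i _ => ?_
    rw [← toFZero_smul, h, map_zero, map_zero]

theorem exists_pdK_of_toLOne_ne_zero (v : P) (h : toLOne n P v ≠ 0) :
    ∃ i, (pdK i : K n) • v ≠ 0 := by
  contrapose! h
  exact toLOne_eq_zero_iff.mpr h

theorem toLOne_injective (hker : ∀ v : P, v ≠ 0 → ∃ i, (pdK i : K n) • v ≠ 0) :
    Function.Injective (toLOne n P) := by
  rw [← LinearMap.ker_eq_bot, LinearMap.ker_eq_bot']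
  intro v hv
  by_contra h
  obtain ⟨i, hi⟩ := hker v h
  exact hi (toLOne_eq_zero_iff.mp hv i)

theorem exists_pdK_of_hP_eq_top [IsSimpleModule (K n) P] (h : hP n P = ⊤) (v : P) (hv : v ≠ 0) :
    ∃ i, (pdK i : K n) • v ≠ 0 := by
  by_contra! hd
  exact hv (eq_zero_of_mem_hP (by rw [h]; trivial) hd)

theorem isIrreducible_F_zero_iff [IsSimpleModule (K n) P] (hn : 2 ≤ n) :
    LieModule.IsIrreducible ℂ (S n) (F n P (Vd n 0)) ↔ hP n P = ⊤ := by
  have := IsSimpleModule.nontrivial (K n) P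
  have : Nontrivial (F n P (Vd n 0)) := nontrivial_F (Nat.zero_le n)
  refine ⟨hP_eq_top_of_isIrreducible lie_toFZero (by omega) (toFZero n P).injective, fun h => ?_⟩
  refine isIrreducible_of_map_hP_eq_top lie_toFZero hn (toFZero n P).surjective ?_ ?_
  · intro v hv
    refine exists_pdK_of_hP_eq_top h v ?_
    rintro rfl
    exact hv (map_zero _)
  · rw [h, Submodule.map_top, LinearEquiv.range]

theorem toFZero_eq_tm (p : P) :
    toFZero n P p = tm n p ((equivVZero n).symm 1) := by
  change (equivFZero n P).symm p = _
  rw [LinearEquiv.symm_apply_eq, equivFZero_tm, LinearEquiv.apply_symm_apply, one_smul]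

theorem tm_eq_toFZero (p : P) (w : Vd n 0) :
    tm n p w = toFZero n P (equivVZero n w • p) := by
  change _ = (equivFZero n P).symm _
  rw [LinearEquiv.eq_symm_apply, equivFZero_tm]

theorem tensorSub_eq_span {V : Type*} [AddCommGroup V] [Module ℂ V] (P' : Submodule ℂ P) :
    tensorSub n P' V = Submodule.span ℂ {y | ∃ p ∈ P', ∃ v : V, y = tm n p v} := rfl

/-- Since `V(δ_0)` is one-dimensional, every subspace of the tensor product is of this form. -/
theorem tensorSub_comap_toFZero (N : Submodule ℂ (F n P (Vd n 0))) :
    N = tensorSub n (N.comap (toFZero n P : P →ₗ[ℂ] F n P (Vd n 0))) (Vd n 0) := by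
  rw [tensorSub_eq_span]
  apply le_antisymm
  · intro z hz
    obtain ⟨p, rfl⟩ := (toFZero n P).surjective z
    rw [toFZero_eq_tm]
    refine Submodule.subset_span ⟨p, hz, _, rfl⟩
  · rw [Submodule.span_le]
    rintro _ ⟨p, hp, w, rfl⟩
    have h1 : toFZero n P (equivVZero n w • p) ∈ N := by
      rw [map_smul]
      exact N.smul_mem _ hp
    rwa [← tm_eq_toFZero] at h1

/-! ### The case of `A_n` -/

theorem mem_Aprime {a : A n} :
    a ∈ Aprime n ↔ a ∈ Submodule.span ℂ {f : A n | ∃ r : Fin n → ℤ, r ≠ 0 ∧ f = mon r} := Iff.rfl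

theorem sub_constCoeff_mem_Aprime (a : A n) : a - constCoeff n a • 1 ∈ Aprime n := by
  rw [mem_Aprime]
  have ha : a ∈ Submodule.span ℂ (Set.range (monBasis n)) := by
    rw [(monBasis n).span_eq]; trivial
  induction ha using Submodule.span_induction with
  | mem b hb =>
    obtain ⟨r, rfl⟩ := hb
    rw [monBasis_apply, constCoeff_mon]
    split_ifs with h
    · rw [h, mon_zero, one_smul, sub_self]; exact zero_mem _
    · rw [zero_smul, sub_zero]; exact Submodule.subset_span ⟨r, h, rfl⟩
  | zero => rw [map_zero, zero_smul, sub_zero]; exact zero_mem _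
  | add a b _ _ ha hb => rw [map_add, add_smul, add_sub_add_comm]; exact add_mem ha hb
  | smul c a _ ha =>
    rw [map_smul, smul_assoc, ← smul_sub]; exact Submodule.smul_mem _ _ ha

theorem mem_hP_of_mem_Aprime {a : A n} (ha : a ∈ Aprime n) : a ∈ hP n (A n) := by
  rw [mem_Aprime] at ha
  refine Submodule.span_le.mpr ?_ ha
  rintro _ ⟨r, hr, rfl⟩
  obtain ⟨i, hi⟩ := Function.ne_iff.mp hr
  have h1 : (r i : ℂ)⁻¹ • (pdK i : K n) • (mon r : A n) = mon r := by
    rw [pdK_smul, pd_mon, smul_smul, inv_mul_cancel₀ (Int.cast_ne_zero.mpr hi), one_smul]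
  rw [SetLike.mem_coe, ← h1]
  exact Submodule.smul_mem _ _ (pdK_smul_mem_hP i _)

theorem constCoeff_eq_zero_of_mem_Aprime {a : A n} (ha : a ∈ Aprime n) : constCoeff n a = 0 :=
  constCoeff_eq_zero_of_mem_hP (mem_hP_of_mem_Aprime ha)

theorem W_one (X : W n) : X (1 : A n) = 0 := Derivation.map_one_eq_zero X

/-- `A_n = A'_n ⊕ ℂ` as `𝕊_n`-modules. -/
def equivAprimeProd (n : ℕ) : A n ≃ₗ⁅ℂ, S n⁆ (Aprime n × TrivialLieModule ℂ (S n) ℂ) where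
  toFun a := (⟨a - constCoeff n a • 1, sub_constCoeff_mem_Aprime a⟩,
    (TrivialLieModule.equiv ℂ (S n) ℂ).symm (constCoeff n a))
  map_add' a b := by
    refine Prod.ext (Subtype.ext ?_) ?_
    · change a + b - constCoeff n (a + b) • 1 =
        a - constCoeff n a • 1 + (b - constCoeff n b • 1)
      rw [map_add, add_smul, add_sub_add_comm]
    · exact map_add (constCoeff n) a b
  map_smul' c a := by
    refine Prod.ext (Subtype.ext ?_) ?_
    · change c • a - constCoeff n (c • a) • 1 = c • (a - constCoeff n a • 1)
      rw [map_smul, smul_assoc, ← smul_sub]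
    · exact map_smul (constCoeff n) c a
  map_lie' := by
    intro X a
    -- Divergence zero fields map `A_n` into `𝔥A_n`, so the projection to the constant coefficient
    -- is equivariant onto the trivial module.
    have h : constCoeff n ⁅X, a⁆ = 0 :=
      constCoeff_eq_zero_of_mem_hP (WtoK_smul_mem_hP X a)
    refine Prod.ext (Subtype.ext ?_) h
    change ⁅X, a⁆ - constCoeff n ⁅X, a⁆ • 1 = ⁅X, a - constCoeff n a • 1⁆
    rw [h, zero_smul, sub_zero, lie_sub, lie_smul]
    have h1 : ⁅X, (1 : A n)⁆ = 0 := W_one (X : W n)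
    rw [h1, smul_zero, sub_zero]
  invFun x := (x.1 : A n) + (TrivialLieModule.equiv ℂ (S n) ℂ) x.2 • 1
  left_inv a := by
    change a - constCoeff n a • 1 + constCoeff n a • 1 = a
    rw [sub_add_cancel]
  right_inv x := by
    have h : constCoeff n ((x.1 : A n) + (TrivialLieModule.equiv ℂ (S n) ℂ) x.2 • 1) =
        (TrivialLieModule.equiv ℂ (S n) ℂ) x.2 := by
      rw [map_add, map_smul, constCoeff_eq_zero_of_mem_Aprime x.1.2, constCoeff_one, zero_add,
        smul_eq_mul, mul_one]
    refine Prod.ext (Subtype.ext ?_) h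
    change (x.1 : A n) + (TrivialLieModule.equiv ℂ (S n) ℂ) x.2 • 1 -
      constCoeff n ((x.1 : A n) + (TrivialLieModule.equiv ℂ (S n) ℂ) x.2 • 1) • 1 = x.1
    rw [h, add_sub_cancel_right]

theorem equiv_WtoK (e : P ≃ₗ[K n] A n) (X : S n) (z : F n P (Vd n 0)) :
    e (equivFZero n P ⁅X, z⁆) = ⁅X, e (equivFZero n P z)⁆ := by
  have h : ⁅X, z⁆ = WtoK n (X : W n) • z := W_lie_zero (X : W n) z
  rw [h, map_smul, map_smul]
  rfl

/-- `𝓕(P, V(δ_0)) ≅ A_n` as `𝕊_n`-modules, if `P ≅ A_n`. -/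
def equivFZeroA (e : P ≃ₗ[K n] A n) : F n P (Vd n 0) ≃ₗ⁅ℂ, S n⁆ A n :=
  { ((equivFZero n P).trans e).restrictScalars ℂ with
    map_lie' := fun {X z} => equiv_WtoK e X z }

/-- Subtracting the constant term changes nothing in `𝓛_n(P, 1)`, because constants are killed by
`𝔥`. -/
theorem exists_mem_Aprime_toLOne_eq (e : P ≃ₗ[K n] A n) (p : P) :
    ∃ a ∈ Aprime n, toLOne n P (e.symm a) = toLOne n P p := by
  refine ⟨_, sub_constCoeff_mem_Aprime (e p), ?_⟩
  rw [← sub_eq_zero, ← map_sub, toLOne_eq_zero_iff]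
  intro i
  apply e.injective
  rw [map_smul, map_sub, e.apply_symm_apply, sub_sub_cancel_left, map_zero, pdK_smul, map_neg,
    Derivation.map_smul, W_one, smul_zero, neg_zero]

theorem map_toLOne_hP_eq_top (e : P ≃ₗ[K n] A n) : (hP n P).map (toLOne n P) = ⊤ := by
  rw [eq_top_iff]
  rintro z -
  obtain ⟨p, rfl⟩ := toLOne_surjective z
  obtain ⟨a, ha, hap⟩ := exists_mem_Aprime_toLOne_eq e p
  exact ⟨_, equiv_mem_hP e.symm (mem_hP_of_mem_Aprime ha), hap⟩

/-- `A'_n ≅ 𝓛_n(P, 1)` as `𝕊_n`-modules, if `P ≅ A_n`. -/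
theorem nonempty_LOne_equiv_Aprime [IsSimpleModule (K n) P] (e : P ≃ₗ[K n] A n) :
    Nonempty (L n P 1 ≃ₗ⁅ℂ, S n⁆ Aprime n) := by
  let f : Aprime n →ₗ⁅ℂ, S n⁆ L n P 1 :=
    { toLinearMap := toLOne n P ∘ₗ (e.symm.toLinearMap.restrictScalars ℂ) ∘ₗ
        (Aprime n).toSubmodule.subtype
      map_lie' := by
        intro X a
        change toLOne n P (e.symm (WtoK n (X : W n) • (a : A n))) = ⁅X, toLOne n P (e.symm a)⁆
        rw [map_smul, lie_toLOne] }
  have hinj : Function.Injective f := by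
    rw [← f.coe_toLinearMap, ← LinearMap.ker_eq_bot, LinearMap.ker_eq_bot']
    intro a ha
    have h1 : toLOne n P (e.symm a) = 0 := ha
    rw [toLOne_eq_zero_iff] at h1
    -- Injectivity on `A'_n`: its elements lie in `𝔥A_n`, which contains no nonzero vector killed by
    -- `𝔥`.
    have h2 := eq_zero_of_mem_hP (equiv_mem_hP e.symm (mem_hP_of_mem_Aprime a.2)) h1
    exact Subtype.ext (e.symm.map_eq_zero_iff.mp h2)
  have hsurj : Function.Surjective f := by
    intro z
    obtain ⟨p, rfl⟩ := toLOne_surjective z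
    obtain ⟨a, ha, hap⟩ := exists_mem_Aprime_toLOne_eq e p
    exact ⟨⟨a, ha⟩, hap⟩
  let g := LinearEquiv.ofBijective f.toLinearMap ⟨hinj, hsurj⟩
  have g' : Aprime n ≃ₗ⁅ℂ, S n⁆ L n P 1 := { g with map_lie' := fun {X a} => f.map_lie X a }
  exact ⟨g'.symm⟩

theorem isIrreducible_LOne_iff [IsSimpleModule (K n) P] (hn : 2 ≤ n) :
    LieModule.IsIrreducible ℂ (S n) (L n P 1) ↔ hP n P = ⊤ ∨ Nonempty (P ≃ₗ[K n] A n) := by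
  have := IsSimpleModule.nontrivial (K n) P
  have : Nontrivial (L n P 1) := (LieSubmodule.nontrivial_iff_ne_bot ℂ (S n) _).mpr
    (L_succ_ne_bot (by omega))
  constructor
  · intro h
    by_cases he : Nonempty (P ≃ₗ[K n] A n)
    · exact Or.inr he
    · rw [not_nonempty_iff] at he
      exact Or.inl (hP_eq_top_of_isIrreducible lie_toLOne (by omega)
        (toLOne_injective fun v hv => exists_pdK_smul_ne_zero he hv) h)
  · intro h
    refine isIrreducible_of_map_hP_eq_top lie_toLOne hn toLOne_surjective
      exists_pdK_of_toLOne_ne_zero ?_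
    obtain h | ⟨⟨e⟩⟩ := h
    · rw [h, Submodule.map_top, LinearMap.range_eq_top]
      exact toLOne_surjective
    · exact map_toLOne_hP_eq_top e

end Degree

end DivZeroTorus

end

open DivZeroTorus
theorem mainTheorem3 (n : ℕ) (hn : 2 ≤ n) (P : Type*) [AddCommGroup P] [Module ℂ P]
    [Module (K n) P] [IsScalarTower ℂ (K n) P] [IsSimpleModule (K n) P] :
    -- (a)
    (LieModule.IsIrreducible ℂ (S n) (F n P (Vd n 0)) ↔ hP n P = ⊤) ∧
    -- (b)
    (∀ k : ℕ, 1 ≤ k → k ≤ n - 1 → ¬ LieModule.IsIrreducible ℂ (S n) (F n P (Vd n k))) ∧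
    -- (c)
    (IsEmpty (P ≃ₗ[K n] A n) →
      IsUniqueSimpleSubmodule (S n) (hMul n (F n P (Vd n 0))) ∧
      ∀ N : LieSubmodule ℂ (S n) (F n P (Vd n 0)), N ≠ ⊥ →
        ∃ P' : Submodule ℂ P, hP n P ≤ P' ∧ N.toSubmodule = tensorSub n P' (Vd n 0)) ∧
    (Nonempty (P ≃ₗ[K n] A n) →
      Nonempty (F n P (Vd n 0) ≃ₗ⁅ℂ, S n⁆ (Aprime n × TrivialLieModule ℂ (S n) ℂ))) ∧
    -- (d)
    (IsEmpty (P ≃ₗ[K n] A n) → IsUniqueSimpleSubmodule (S n) (hMul n (L n P 1))) ∧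
    (Nonempty (P ≃ₗ[K n] A n) →
      hMul n (L n P 1) = ⊤ ∧ Nonempty (L n P 1 ≃ₗ⁅ℂ, S n⁆ Aprime n)) ∧
    (LieModule.IsIrreducible ℂ (S n) (L n P 1) ↔
      hP n P = ⊤ ∨ Nonempty (P ≃ₗ[K n] A n)) ∧
    -- (e)
    (3 ≤ n → ∀ k : ℕ, 2 ≤ k → k ≤ n - 1 →
      LieModule.IsIrreducible ℂ (S n) (L n P k) ∧ IsCoatom (Ltilde n P k)) := by
  have hker : IsEmpty (P ≃ₗ[K n] A n) → ∀ v : P, v ≠ 0 → ∃ i, (pdK i : K n) • v ≠ 0 :=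
    fun h v hv => exists_pdK_smul_ne_zero h hv
  refine ⟨isIrreducible_F_zero_iff hn, ?_, ?_, ?_, ?_, ?_, isIrreducible_LOne_iff hn, ?_⟩
  · intro k hk1 hk
    obtain ⟨k, rfl⟩ := Nat.exists_eq_add_of_le' hk1
    exact not_isIrreducible_F (by omega)
  · intro h
    refine ⟨isUniqueSimpleSubmodule_hMul lie_toFZero hn (toFZero n P).bijective (hker h), ?_⟩
    intro N hN
    refine ⟨_, hP_le_comap lie_toFZero hn (toFZero n P).surjective ?_ hN,
      tensorSub_comap_toFZero N.toSubmodule⟩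
    intro v hv
    refine hker h v ?_
    rintro rfl
    exact hv (map_zero _)
  · rintro ⟨e⟩
    exact ⟨(equivFZeroA e).trans (equivAprimeProd n)⟩
  · intro h
    exact isUniqueSimpleSubmodule_hMul lie_toLOne hn
      ⟨toLOne_injective (hker h), toLOne_surjective⟩ (hker h)
  · rintro ⟨e⟩
    refine ⟨?_, nonempty_LOne_equiv_Aprime e⟩
    rw [hMul_eq_map lie_toLOne toLOne_surjective, map_toLOne_hP_eq_top e]
  · intro _ k hk2 hk
    obtain ⟨k, rfl⟩ := Nat.exists_eq_add_of_le' hk2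
    exact ⟨isIrreducible_L (by omega), isCoatom_Ltilde (by omega)⟩
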